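/- Let $L\ge 3$ be an integer, $\alpha\in(L-1,L]$ and $\alpha'=\alpha-L+1\in(0,1]$. **Gluing maps.** Let $\varphi_{k,k+1}:(0,+\infty)\to\mathbb R$, $1\le k\le L-1$, be continuous maps with $\varphi_{k,k+1}(y)\to-\infty$ as $y\to0^+$, with the following properties ("increasing" is meant in the weak sense; an interval is non-trivial if it has more than one point). * $\varphi_{1,2}$ is negative and increasing. For each integer $k_1\ge1$ it is equal to $-k_1$ on a non-trivial interval $I_{k_1}\subset(0,\frac23]$, and the intervals $I_{k_1}$ tend to $0$ as $k_1\to+\infty$. The interval $I_{k_1}$ is called a step of order $k_1$ of $\varphi_{1,2}$. * For $2\le j\le L-1$, on each step $I_{k_1,\dots,k_{j-1}}$ of order $k_1$ of $\varphi_{j-1,j}$ the map $\varphi_{j,j+1}$ is increasing, and for each integer $k_j$ with $k_1\le k_j\le 2k_1$ if $j<L-1$, respectively $k_1\le k_{L-1}\le k_1+k_1^{\alpha'}$ if $j=L-1$, it takes the value $-k_j$ on a non-trivial subinterval $I_{k_1,\dots,k_j}\subset I_{k_1,\dots,k_{j-1}}$. These subintervals are called the steps of order $k_1$ of $\varphi_{j,j+1}$.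 * For $2\le j\le L-1$, the map $\varphi_{j,j+1}$ is monotone (increasing or decreasing) between any two successive steps of $\varphi_{j,j+1}$ (of the same order or not). **Glued plane.** Let $P_1,\dots,P_L$ be copies of $\mathbb R^2$ and let $P$ be the quotient of their disjoint union by the equivalence relation generated by identifying, for $1\le k\le L-1$ and $y>0$, the point $(x,y)\in P_k$ with $(x+\varphi_{k,k+1}(y),y)\in P_{k+1}$. The translations $(x,y)\mapsto(x+1,y)$ of the copies $P_k$ induce a map $P\to P$; let $f$ be its extension to the one-point compactification $X=P\cup\{\infty\}$ that fixes $\infty$. **Polynomial entropy of a family.** For a finite family $\mathcal F$ of non-empty subsets of $X\setminus\{\infty\}$, let $\infty_{\mathcal F}$ be the complement in $X$ of the union of $\mathcal F$. For $n\ge1$ let $\mathcal A_n(\mathcal F)$ be the set of words $(w_0,\dots,w_{n-1})$ with letters in $\mathcal F\cup\{\infty_{\mathcal F}\}$ such that there is $x\in X$ with $f^k(x)\in w_k$ for $0\le k\le n-1$. Put $$h_{pol}(\mathcal F)=\limsup_{n\to\infty}\frac{\log\#\mathcal A_n(\mathcal F)}{\log n}.$$ **Claim.** Let $U_i\subset P$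 be the image of the square $[-\frac23,\frac23]^2$ of $P_i$, for $1\le i\le L$. Then $$h_{pol}(\{U_1,\dots,U_L\})=\alpha.$$ -/

import Mathlib

open Set Filter Topology

noncomputable section

/-! ### Polynomial entropy of a finite family of sets -/

section Coding

variable {X : Type*}

/-- The words `(w₀, …, w_{n-1})` in the letters `F ∪ {∞_F}`, where `∞_F` is the complement of the
union of `F`, that code some orbit `(x, f x, …, f^{n-1} x)`, that is, `f^k x ∈ w_k` for all `k`. -/
def codings (f : X → X) (F : Set (Set X)) (n : ℕ) : Set (Fin n → Set X) :=
  {w | (∀ k, w k ∈ insert (⋃₀ F)ᶜ F) ∧ ∃ x, ∀ k : Fin n, f^[k] x ∈ w k}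

/-- The polynomial entropy `limsup log #A_n(F) / log n` of a finite family `F`. The limsup is taken
in the extended reals; for finite `F` each set of words is finite. -/
def polEntropy (f : X → X) (F : Set (Set X)) : EReal :=
  limsup (fun n : ℕ => ((Real.log (codings f F n).ncard / Real.log n : ℝ) : EReal)) atTop

end Coding

/-! ### Gluing translations

The copies of the plane are numbered `0, …, L - 1`, and `φ k` glues the open upper half plane of
copy `k` to that of copy `k + 1`. Only the values `φ k y` with `k + 1 < L` and `0 < y` matter. -/

/-- The generating identifications: `(x, y)` in copy `k` with `y > 0` is identified with
`(x + φ k y, y)` in copy `k + 1`. -/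
inductive GlueRel (L : ℕ) (φ : ℕ → ℝ → ℝ) : Fin L × (ℝ × ℝ) → Fin L × (ℝ × ℝ) → Prop
  | glue (i j : Fin L) (hij : (j : ℕ) = (i : ℕ) + 1) (x y : ℝ) (hy : 0 < y) :
      GlueRel L φ (i, (x, y)) (j, (x + φ i y, y))

/-- The glued plane: the quotient of the disjoint union of the `L` copies of the plane by the
equivalence relation generated by `GlueRel`. -/
def GluedPlane (L : ℕ) (φ : ℕ → ℝ → ℝ) : Type := Quot (GlueRel L φ)

/-- The quotient topology. -/
instance instTopologicalSpaceGluedPlane (L : ℕ) (φ : ℕ → ℝ → ℝ) : TopologicalSpace (GluedPlane L φ) :=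
  inferInstanceAs (TopologicalSpace (Quot (GlueRel L φ)))

/-- The point of the glued plane with coordinates `q` in copy `i`. -/
def GluedPlane.mk (L : ℕ) (φ : ℕ → ℝ → ℝ) (i : Fin L) (q : ℝ × ℝ) : GluedPlane L φ :=
  Quot.mk (GlueRel L φ) (i, q)

/-- The map induced on the glued plane by the translation `(x, y) ↦ (x + 1, y)` of each copy. -/
def gluedTranslation (L : ℕ) (φ : ℕ → ℝ → ℝ) : GluedPlane L φ → GluedPlane L φ :=
  Quot.map (fun p => (p.1, (p.2.1 + 1, p.2.2))) (by
    rintro _ _ ⟨i, j, hij, x, y, hy⟩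
    have h := GlueRel.glue (φ := φ) i j hij (x + 1) y hy
    rwa [add_right_comm] at h)

/-- The extension of `gluedTranslation` to the one-point compactification, fixing the point at
infinity. -/
def compactifiedTranslation (L : ℕ) (φ : ℕ → ℝ → ℝ) :
    OnePoint (GluedPlane L φ) → OnePoint (GluedPlane L φ) :=
  OnePoint.map (gluedTranslation L φ)

/-- The square `[-2/3, 2/3]²` of copy `i`, as a subset of the compactified glued plane. -/
def gluedSquare (L : ℕ) (φ : ℕ → ℝ → ℝ) (i : Fin L) : Set (OnePoint (GluedPlane L φ)) :=
  (fun q : ℝ × ℝ => (GluedPlane.mk L φ i q : OnePoint (GluedPlane L φ)))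
    '' (Icc (-(2 / 3)) (2 / 3) ×ˢ Icc (-(2 / 3)) (2 / 3))

/-! ### The twisted gluing maps -/

/-- `stepTop L α j k` is the upper end of the range, whose lower end is `k`, of the integers `m`
such that `φ j` has steps of order `k` with value `-m`, for `1 ≤ j ≤ L - 2`. It is `2 k`, except for
the last gluing map `φ (L - 2)`, where it is `k + k ^ (α - L + 1)`. -/
def stepTop (L : ℕ) (α : ℝ) (j k : ℕ) : ℝ :=
  if j + 2 = L then (k : ℝ) + (k : ℝ) ^ (α - (L : ℝ) + 1) else 2 * (k : ℝ)

/-- `IsStepIndex L α k w` says that `(k, w₀, w₁, …)` is the index of a step: the order `k` is a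
positive integer, and each later integer `wᵢ` lies in the range prescribed for the values of
`φ (i + 1)`. The index `(k, w)` belongs to a step of the gluing map `φ w.length`. -/
def IsStepIndex (L : ℕ) (α : ℝ) (k : ℕ) (w : List ℕ) : Prop :=
  1 ≤ k ∧ ∀ (i : ℕ) (hi : i < w.length), k ≤ w[i] ∧ (w[i] : ℝ) ≤ stepTop L α (i + 1) k

/-- Every point of `A` is smaller than every point of `B`. -/
def SetLT (A B : Set ℝ) : Prop := ∀ a ∈ A, ∀ b ∈ B, a < b

/-- The points that lie between `A` and `B`. -/
def gapBetween (A B : Set ℝ) : Set ℝ := {y | (∀ a ∈ A, a ≤ y) ∧ ∀ b ∈ B, y ≤ b}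

/-- The assumptions on the gluing maps `φ 0, …, φ (L - 2)`, with `I k w` the step with index
`(k, w)`. An interval is an order-connected set, and it is non trivial if it has two points. -/
structure IsTwistedGluing (L : ℕ) (α : ℝ) (φ : ℕ → ℝ → ℝ) (I : ℕ → List ℕ → Set ℝ) : Prop where
  /-- The gluing maps are continuous on `(0, ∞)`. -/
  continuousOn : ∀ j, j + 1 < L → ContinuousOn (φ j) (Ioi 0)
  /-- The gluing maps tend to `-∞` at `0`. -/
  tendsto_atBot : ∀ j, j + 1 < L → Tendsto (φ j) (𝓝[>] 0) atBot
  /-- The first gluing map is negative. -/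
  first_neg : ∀ y, 0 < y → φ 0 y < 0
  /-- The first gluing map is (weakly) increasing. -/
  first_mono : MonotoneOn (φ 0) (Ioi 0)
  /-- For each positive integer `k` the first gluing map equals `-k` on a non trivial interval
  contained in `(0, 2/3]`. -/
  first_step : ∀ k : ℕ, 1 ≤ k → (I k []).OrdConnected ∧ (I k []).Nontrivial ∧
    I k [] ⊆ Ioc 0 (2 / 3) ∧ ∀ y ∈ I k [], φ 0 y = -(k : ℝ)
  /-- These intervals tend to `0`. -/
  first_tendsto : ∀ ε : ℝ, 0 < ε → ∀ᶠ k in atTop, I k [] ⊆ Ioo 0 ε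
  /-- Each gluing map is (weakly) increasing on each step of the preceding one. -/
  step_mono : ∀ (k : ℕ) (w : List ℕ), w.length + 2 < L → IsStepIndex L α k w →
    MonotoneOn (φ (w.length + 1)) (I k w)
  /-- On each step of order `k` of the preceding gluing map, each gluing map takes each value `-m`,
  with `m` an integer of the prescribed range, on a non trivial subinterval. -/
  sub_step : ∀ (k : ℕ) (w : List ℕ) (m : ℕ), w.length + 2 < L → IsStepIndex L α k (w ++ [m]) →
    (I k (w ++ [m])).OrdConnected ∧ (I k (w ++ [m])).Nontrivial ∧ I k (w ++ [m]) ⊆ I k w ∧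
      ∀ y ∈ I k (w ++ [m]), φ (w.length + 1) y = -(m : ℝ)
  /-- Each gluing map after the first is monotone (in one direction or the other) between two
  successive steps of it, of the same order or not. -/
  monotone_between : ∀ j, 1 ≤ j → j + 1 < L →
    ∀ (k : ℕ) (w : List ℕ) (k' : ℕ) (w' : List ℕ), w.length = j → w'.length = j →
      IsStepIndex L α k w → IsStepIndex L α k' w' → SetLT (I k w) (I k' w') →
      (¬ ∃ (l : ℕ) (v : List ℕ), v.length = j ∧ IsStepIndex L α l v ∧
        SetLT (I k w) (I l v) ∧ SetLT (I l v) (I k' w')) →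
      MonotoneOn (φ j) (gapBetween (I k w) (I k' w')) ∨
        AntitoneOn (φ j) (gapBetween (I k w) (I k' w'))

end

/-! Write `α' = α - L + 1`, with the gluing maps numbered `φ 0, …, φ (L - 2)`. An orbit at height `y
> 0` drifts by one unit per iterate and passes the square of copy `l` when its abscissa in copy `0`
is close to `-(φ 0 y + ⋯ + φ (l - 1) y)`. Up to bounded errors a word is therefore given by one
visiting time and the integer parts of `φ 0 y, …, φ (L - 2) y`. There are about `n` choices for the
time, so the claim is that about `n ^ (α - 1)` tuples of integer parts matter for words of length
`n`.

Upper bound. If all gluing maps are below `-n` by a margin at `y`, an orbit segment of length `n`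
meets at most one square; away from `0` the maps are bounded and all visits are close together. In
between, the tuples are counted by variation: an integer tuple changes only if some entry jumps by
at least `1`, so it takes at most one value more than its total variation
(`ncard_image_le_of_sum_eVariationOn_le`). On a step of `φ (j - 1)` of order `k`, the map `φ j`
climbs from its lowest step value to `-k`; between successive steps it is monotone, so it moves no
more than the difference of the two step values. With `r` the oscillation on one such climb (at most
`k`, or `k ^ α'` for the last map), the tree of steps gives `φ j`, `j ≥ 1`, a variation of order at
most `k ^ (j - 1) * r` between the orders `k + 1` and `k` (`floorVariationLE_step`,
`floorVariationLE_gap`, `floorVariationLE_gap_order`). Summing over `k < N` gives at most a constant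
times `N ^ (α - 1)` (`exists_order_points`). A bounded error in the visiting times costs only a
constant factor (`ncard_codings_le`).

Lower bound. On a step of the last map all the gluing maps are integers, and a suitable orbit visits
each square at exactly one time, so its word recovers its starting time and all these integers
(`exists_coding_of_values`). With orders in `[M, 2M)` and `M` proportional to `n` there are at least
`M ^ α` choices (`rpow_le_ncard_codings`). Both bounds are constants times `n ^ α`, so the limsup is
a limit. -/

/-! ### Variation of integer-valued functions -/

/-- A tuple of integer-valued functions whose variations on `s` add up to at most `R` takes at most
`R + 1` values on `s`. -/
theorem ncard_image_le_of_sum_eVariationOn_le {ι : Type*} [Fintype ι] (f : ℝ → ι → ℤ) (s : Set ℝ)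
    (R : ℕ) (hR : ∑ i, eVariationOn (fun y => (f y i : ℝ)) s ≤ R) :
    (f '' s).Finite ∧ (f '' s).ncard ≤ R + 1 := by
  -- `p y` is the variation accumulated up to `y`. It grows by at least `1` whenever the tuple
  -- changes, so `⌊p y⌋` determines the tuple.
  set p : ℝ → ENNReal := fun y => ∑ i, eVariationOn (fun y => (f y i : ℝ)) (s ∩ Iic y) with hp
  have hpR : ∀ y, p y ≤ R := fun y => le_trans
    (Finset.sum_le_sum fun i _ => eVariationOn.mono _ inter_subset_left) hR
  have hptop : ∀ y, p y ≠ ⊤ := fun y => ne_top_of_le_ne_top (ENNReal.natCast_ne_top R) (hpR y)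
  have hstep : ∀ y ∈ s, ∀ y' ∈ s, y < y' → f y ≠ f y' → p y + 1 ≤ p y' := by
    intro y hy y' hy' hlt hne
    obtain ⟨i₀, hi₀⟩ := Function.ne_iff.1 hne
    have h1 : ∀ i, eVariationOn (fun y => (f y i : ℝ)) (s ∩ Iic y) + edist (f y i : ℝ) (f y' i : ℝ)
        ≤ eVariationOn (fun y => (f y i : ℝ)) (s ∩ Iic y') := by
      intro i
      have h2 := eVariationOn.add_le_union (fun y => (f y i : ℝ)) (s := s ∩ Iic y) (t := {y, y'})
        (by
          rintro a ⟨-, ha⟩ b (rfl | rfl)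
          · exact ha
          · exact le_trans ha hlt.le)
      rw [eVariationOn.pair] at h2
      refine h2.trans (eVariationOn.mono _ ?_)
      rintro a (⟨ha, ha'⟩ | rfl | rfl)
      · exact ⟨ha, le_trans ha' hlt.le⟩
      · exact ⟨hy, hlt.le⟩
      · exact ⟨hy', le_refl a⟩
    have h3 : (1 : ENNReal) ≤ ∑ i, edist (f y i : ℝ) (f y' i : ℝ) := by
      refine le_trans ?_ (Finset.single_le_sum (f := fun i => edist (f y i : ℝ) (f y' i : ℝ))
        (fun _ _ => zero_le) (Finset.mem_univ i₀))
      have h4 : (1 : ℤ) ≤ |f y i₀ - f y' i₀| := Int.one_le_abs (sub_ne_zero.2 hi₀)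
      have h5 : (1 : ℝ) ≤ |(f y i₀ : ℝ) - f y' i₀| := by exact_mod_cast h4
      rw [edist_dist, Real.dist_eq]
      simpa using ENNReal.ofReal_le_ofReal h5
    calc p y + 1 ≤ p y + ∑ i, edist (f y i : ℝ) (f y' i : ℝ) := by gcongr
      _ = ∑ i, (eVariationOn (fun y => (f y i : ℝ)) (s ∩ Iic y)
          + edist (f y i : ℝ) (f y' i : ℝ)) := by rw [hp, Finset.sum_add_distrib]
      _ ≤ p y' := Finset.sum_le_sum fun i _ => h1 i
  have hfloor : ∀ y ∈ s, ∀ y' ∈ s, y < y' → ⌊(p y).toReal⌋₊ = ⌊(p y').toReal⌋₊ → f y = f y' := by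
    intro y hy y' hy' hlt he
    by_contra hne
    have h1 := hstep y hy y' hy' hlt hne
    have h2 : (p y).toReal + 1 ≤ (p y').toReal := by
      have := ENNReal.toReal_mono (hptop y') h1
      rwa [ENNReal.toReal_add (hptop y) ENNReal.one_ne_top, ENNReal.toReal_one] at this
    have h3 := Nat.floor_mono h2
    rw [Nat.floor_add_one ENNReal.toReal_nonneg] at h3
    omega
  have hfactor : ∀ y ∈ s, ∀ y' ∈ s, ⌊(p y).toReal⌋₊ = ⌊(p y').toReal⌋₊ → f y = f y' := by
    intro y hy y' hy' he
    rcases lt_trichotomy y y' with h | h | h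
    · exact hfloor y hy y' hy' h he
    · rw [h]
    · exact (hfloor y' hy' y hy h he.symm).symm
  choose! rep hrep using fun v (hv : v ∈ f '' s) => hv
  have hmaps : MapsTo (fun v => ⌊(p (rep v)).toReal⌋₊) (f '' s) (Iic R) := by
    intro v _
    have := ENNReal.toReal_mono (ENNReal.natCast_ne_top R) (hpR (rep v))
    rw [ENNReal.toReal_natCast] at this
    exact Nat.floor_le_of_le this
  have hinj : InjOn (fun v => ⌊(p (rep v)).toReal⌋₊) (f '' s) := by
    intro v hv v' hv' he
    rw [← (hrep v hv).2, ← (hrep v' hv').2]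
    exact hfactor _ (hrep v hv).1 _ (hrep v' hv').1 he
  refine ⟨Set.Finite.of_injOn hmaps hinj (finite_Iic R), ?_⟩
  have := ncard_le_ncard_of_injOn _ hmaps hinj (finite_Iic R)
  rwa [← Finset.coe_Iic, ncard_coe_finset, Nat.card_Iic] at this

/-- Subadditivity in this form needs no order between the three points, so estimates can be chained
before the points are known to be ordered. -/
theorem eVariationOn_Icc_le_add (f : ℝ → ℝ) (a b c : ℝ) :
    eVariationOn f (Icc a c) ≤ eVariationOn f (Icc a b) + eVariationOn f (Icc b c) := by
  rcases le_total a b with hab | hab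
  · rcases le_total b c with hbc | hbc
    · have := eVariationOn.Icc_add_Icc f (s := univ) hab hbc (mem_univ b)
      simp only [univ_inter] at this
      rw [this]
    · exact le_trans (eVariationOn.mono f (Icc_subset_Icc_right hbc)) le_self_add
  · exact le_trans (eVariationOn.mono f (Icc_subset_Icc_left hab)) le_add_self

/-- On `s` the function `g` is at most `-k` and its integer part has variation at most `R`. -/
def FloorVariationLE (g : ℝ → ℝ) (k R : ℕ) (s : Set ℝ) : Prop :=
  eVariationOn (fun y => (⌊g y⌋ : ℝ)) s ≤ R ∧ ∀ y ∈ s, g y ≤ -(k : ℝ)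

namespace FloorVariationLE

variable {g : ℝ → ℝ} {k R : ℕ} {s : Set ℝ}

theorem mono {R' : ℕ} {t : Set ℝ} (h : FloorVariationLE g k R s) (hR : R ≤ R') (ht : t ⊆ s) :
    FloorVariationLE g k R' t :=
  ⟨(eVariationOn.mono _ ht).trans (h.1.trans (by exact_mod_cast hR)), fun y hy => h.2 y (ht hy)⟩

theorem trans {R' : ℕ} {a b c : ℝ} (h : FloorVariationLE g k R (Icc a b))
    (h' : FloorVariationLE g k R' (Icc b c)) : FloorVariationLE g k (R + R') (Icc a c) := by
  refine ⟨(eVariationOn_Icc_le_add _ a b c).trans ?_, fun y hy => ?_⟩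
  · push_cast
    exact add_le_add h.1 h'.1
  · rcases le_total y b with hb | hb
    · exact h.2 y ⟨hy.1, hb⟩
    · exact h'.2 y ⟨hb, hy.2⟩

theorem of_const {m : ℕ} (hm : k ≤ m) (h : ∀ y ∈ s, g y = -(m : ℝ)) :
    FloorVariationLE g k 0 s := by
  refine ⟨le_of_eq ?_, fun y hy => ?_⟩
  · rw [eVariationOn.constant_on, Nat.cast_zero]
    rintro _ ⟨y, hy, rfl⟩ _ ⟨z, hz, rfl⟩
    simp only [h y hy, h z hz]
  · rw [h y hy, neg_le_neg_iff]
    exact_mod_cast hm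

theorem of_monotoneOn {p q : ℕ} {a b : ℝ} (hg : MonotoneOn g (Icc a b)) (ha : g a = -(p : ℝ))
    (hb : g b = -(q : ℝ)) (hk : k ≤ q) (hR : p ≤ q + R) : FloorVariationLE g k R (Icc a b) := by
  rcases lt_or_ge b a with hab | hab
  · rw [Icc_eq_empty (not_le.2 hab)]
    exact ⟨by rw [eVariationOn.subsingleton _ subsingleton_empty]; exact zero_le, by simp⟩
  refine ⟨?_, fun y hy => ?_⟩
  · have hm : MonotoneOn (fun y => (⌊g y⌋ : ℝ)) (Icc a b) := fun y hy z hz hyz =>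
      Int.cast_le.2 (Int.floor_mono (hg hy hz hyz))
    have := hm.eVariationOn_eq (left_mem_Icc.2 hab) (right_mem_Icc.2 hab)
    rw [inter_self] at this
    have h1 : ⌊-(p : ℝ)⌋ = -(p : ℤ) := by
      rw [Int.floor_eq_iff]; push_cast; constructor <;> linarith
    have h2 : ⌊-(q : ℝ)⌋ = -(q : ℤ) := by
      rw [Int.floor_eq_iff]; push_cast; constructor <;> linarith
    rw [this, ha, hb, h1, h2, ← ENNReal.ofReal_natCast]
    apply ENNReal.ofReal_le_ofReal
    have : (p : ℝ) ≤ q + R := by exact_mod_cast hR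
    push_cast
    linarith
  · have := hg hy (right_mem_Icc.2 hab) hy.2
    have hk' : (k : ℝ) ≤ q := by exact_mod_cast hk
    linarith

theorem of_antitoneOn {p q : ℕ} {a b : ℝ} (hg : AntitoneOn g (Icc a b)) (ha : g a = -(p : ℝ))
    (hb : g b = -(q : ℝ)) (hk : k ≤ p) (hR : q ≤ p + R) : FloorVariationLE g k R (Icc a b) := by
  rcases lt_or_ge b a with hab | hab
  · rw [Icc_eq_empty (not_le.2 hab)]
    exact ⟨by rw [eVariationOn.subsingleton _ subsingleton_empty]; exact zero_le, by simp⟩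
  refine ⟨?_, fun y hy => ?_⟩
  · have hm : MonotoneOn (fun y => -(⌊g y⌋ : ℝ)) (Icc a b) := fun y hy z hz hyz =>
      neg_le_neg (Int.cast_le.2 (Int.floor_mono (hg hy hz hyz)))
    have := hm.eVariationOn_eq (left_mem_Icc.2 hab) (right_mem_Icc.2 hab)
    rw [inter_self] at this
    have h0 : eVariationOn (fun y => -(⌊g y⌋ : ℝ)) (Icc a b)
        = eVariationOn (fun y => (⌊g y⌋ : ℝ)) (Icc a b) := by
      unfold eVariationOn
      simp only [edist_neg_neg]
    have h1 : ⌊-(p : ℝ)⌋ = -(p : ℤ) := by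
      rw [Int.floor_eq_iff]; push_cast; constructor <;> linarith
    have h2 : ⌊-(q : ℝ)⌋ = -(q : ℤ) := by
      rw [Int.floor_eq_iff]; push_cast; constructor <;> linarith
    rw [← h0, this, ha, hb, h1, h2, ← ENNReal.ofReal_natCast]
    apply ENNReal.ofReal_le_ofReal
    have : (q : ℝ) ≤ p + R := by exact_mod_cast hR
    push_cast
    linarith
  · have := hg (left_mem_Icc.2 hab) hy hy.1
    have hk' : (k : ℝ) ≤ p := by exact_mod_cast hk
    linarith

/-- Variation across the gap between two intervals on which `g` is constant. -/
theorem of_gapBetween {A B : Set ℝ} {a b : ℝ} {p q : ℕ} (hg : ContinuousOn g (Ioi 0))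
    (hA0 : A ⊆ Ioi 0) (hA : A.OrdConnected) (hB : B.OrdConnected) (ha : a ∈ A) (hb : b ∈ B)
    (hAB : SetLT A B) (hgA : ∀ y ∈ A, g y = -(p : ℝ)) (hgB : ∀ y ∈ B, g y = -(q : ℝ))
    (hmono : MonotoneOn g (gapBetween A B) ∨ AntitoneOn g (gapBetween A B))
    (hkp : k ≤ p) (hkq : k ≤ q) (hpq : p ≤ q + R) (hqp : q ≤ p + R) :
    FloorVariationLE g k R (Icc a b) := by
  have hAbdd : BddAbove A := ⟨b, fun x hx => (hAB x hx b hb).le⟩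
  have hBbdd : BddBelow B := ⟨a, fun x hx => (hAB a ha x hx).le⟩
  set u := sSup A with hu
  set v := sInf B with hv
  have hau : a ≤ u := le_csSup hAbdd ha
  have hvb : v ≤ b := csInf_le hBbdd hb
  have huB : ∀ x ∈ B, u ≤ x := fun x hx => csSup_le ⟨a, ha⟩ fun z hz => (hAB z hz x hx).le
  have huv : u ≤ v := le_csInf ⟨b, hb⟩ huB
  -- By continuity the constant values persist at the ends `u` and `v` of the gap, which need not
  -- belong to `A` and `B`.
  have hgu : g u = -(p : ℝ) := by
    have hc : ContinuousAt g u := hg.continuousAt (Ioi_mem_nhds (lt_of_lt_of_le (hA0 ha) hau))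
    have hcl : u ∈ closure A := csSup_mem_closure ⟨a, ha⟩ hAbdd
    have hmem : g u ∈ closure ({-(p : ℝ)} : Set ℝ) :=
      closure_mono (by rintro _ ⟨y, hy, rfl⟩; exact hgA y hy)
        (mem_closure_image hc hcl)
    simpa using hmem
  have hgv : g v = -(q : ℝ) := by
    have hc : ContinuousAt g v :=
      hg.continuousAt (Ioi_mem_nhds (lt_of_lt_of_le (hA0 ha) (hau.trans huv)))
    have hcl : v ∈ closure B := csInf_mem_closure ⟨b, hb⟩ hBbdd
    have hmem : g v ∈ closure ({-(q : ℝ)} : Set ℝ) :=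
      closure_mono (by rintro _ ⟨y, hy, rfl⟩; exact hgB y hy)
        (mem_closure_image hc hcl)
    simpa using hmem
  have h1 : FloorVariationLE g k 0 (Icc a u) := by
    refine of_const hkp fun y hy => ?_
    rcases hy.2.eq_or_lt with h | h
    · rw [h, hgu]
    · obtain ⟨z, hz, hyz⟩ := exists_lt_of_lt_csSup ⟨a, ha⟩ h
      exact hgA y (hA.out ha hz ⟨hy.1, hyz.le⟩)
  have h3 : FloorVariationLE g k 0 (Icc v b) := by
    refine of_const hkq fun y hy => ?_
    rcases hy.1.eq_or_lt with h | h
    · rw [← h, hgv]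
    · obtain ⟨z, hz, hyz⟩ := exists_lt_of_csInf_lt ⟨b, hb⟩ h
      exact hgB y (hB.out hz hb ⟨hyz.le, hy.2⟩)
  have hgap : Icc u v ⊆ gapBetween A B := fun y hy =>
    ⟨fun x hx => (le_csSup hAbdd hx).trans hy.1, fun x hx => hy.2.trans (csInf_le hBbdd hx)⟩
  have h2 : FloorVariationLE g k R (Icc u v) := by
    rcases hmono with hm | hm
    · exact of_monotoneOn (hm.mono hgap) hgu hgv hkq hpq
    · exact of_antitoneOn (hm.mono hgap) hgu hgv hkp hqp
  have := (h1.trans h2).trans h3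
  simpa using this

end FloorVariationLE

/-! ### Indices of steps -/

/-- The largest integer of the range of values prescribed for the steps of order `k` of `φ j`. -/
noncomputable def stepTopNat (L : ℕ) (α : ℝ) (j k : ℕ) : ℕ := ⌊stepTop L α j k⌋₊

/-- The list obtained from `v` by adding `d` entries, the entry in position `i` being
`c (i + 1)`. -/
def extendIndex (c : ℕ → ℕ) : ℕ → List ℕ → List ℕ
  | 0, v => v
  | d + 1, v => extendIndex c d (v ++ [c (v.length + 1)])

theorem extendIndex_add (c : ℕ → ℕ) (d d' : ℕ) (v : List ℕ) :
    extendIndex c (d + d') v = extendIndex c d' (extendIndex c d v) := by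
  induction d generalizing v with
  | zero => simp [extendIndex]
  | succ d ih => rw [Nat.succ_add, extendIndex, ih, extendIndex]

theorem length_extendIndex (c : ℕ → ℕ) (d : ℕ) (v : List ℕ) :
    (extendIndex c d v).length = v.length + d := by
  induction d generalizing v with
  | zero => simp [extendIndex]
  | succ d ih => rw [extendIndex, ih, List.length_append, List.length_singleton]; omega

theorem extendIndex_succ (c : ℕ → ℕ) (d : ℕ) (v : List ℕ) :
    extendIndex c (d + 1) v = extendIndex c d v ++ [c (v.length + d + 1)] := by
  rw [extendIndex_add c d 1, extendIndex, extendIndex, length_extendIndex]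

theorem exists_extendIndex_eq_append (c : ℕ → ℕ) (d : ℕ) (v : List ℕ) :
    ∃ t, extendIndex c d v = v ++ t := by
  induction d generalizing v with
  | zero => exact ⟨[], by simp [extendIndex]⟩
  | succ d ih =>
    obtain ⟨t, ht⟩ := ih v
    exact ⟨t ++ [c (v.length + d + 1)], by rw [extendIndex_succ, ht, List.append_assoc]⟩

section Index

variable {L : ℕ} {α : ℝ} {k : ℕ}

theorem le_stepTop (k j : ℕ) : (k : ℝ) ≤ stepTop L α j k := by
  unfold stepTop
  have h0 : (0 : ℝ) ≤ k := Nat.cast_nonneg k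
  split_ifs
  · have := Real.rpow_nonneg h0 (α - L + 1)
    linarith
  · linarith

theorem le_stepTopNat (k j : ℕ) : k ≤ stepTopNat L α j k :=
  Nat.le_floor (le_stepTop k j)

theorem stepTopNat_le (k j : ℕ) : (stepTopNat L α j k : ℝ) ≤ stepTop L α j k :=
  Nat.floor_le ((Nat.cast_nonneg k).trans (le_stepTop k j))

theorem stepTop_le (hα : α ≤ L) (hk : 1 ≤ k) (j : ℕ) : stepTop L α j k ≤ 2 * (k : ℝ) := by
  have h0 : (1 : ℝ) ≤ k := by exact_mod_cast hk
  unfold stepTop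
  split_ifs
  · have := Real.rpow_le_rpow_of_exponent_le h0 (show α - L + 1 ≤ 1 by linarith)
    rw [Real.rpow_one] at this
    linarith
  · exact le_rfl

theorem stepTopNat_le_two_mul (hα : α ≤ L) (hk : 1 ≤ k) (j : ℕ) :
    stepTopNat L α j k ≤ 2 * k := by
  have := (stepTopNat_le k j).trans (stepTop_le hα hk j)
  exact_mod_cast this

namespace IsStepIndex

theorem nil (hk : 1 ≤ k) : IsStepIndex L α k [] := ⟨hk, fun i hi => by simp at hi⟩

theorem of_append {w t : List ℕ} (h : IsStepIndex L α k (w ++ t)) : IsStepIndex L α k w := by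
  refine ⟨h.1, fun i hi => ?_⟩
  have := h.2 i (by rw [List.length_append]; omega)
  rwa [List.getElem_append_left hi] at this

theorem snoc_iff {w : List ℕ} {m : ℕ} : IsStepIndex L α k (w ++ [m]) ↔
    IsStepIndex L α k w ∧ k ≤ m ∧ (m : ℝ) ≤ stepTop L α (w.length + 1) k := by
  constructor
  · intro h
    have := h.2 w.length (by simp)
    simp only [List.getElem_concat_length] at this
    exact ⟨h.of_append, this⟩
  · rintro ⟨h, hm⟩
    refine ⟨h.1, fun i hi => ?_⟩
    rcases Nat.lt_or_ge i w.length with hi' | hi'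
    · rw [List.getElem_append_left hi']
      exact h.2 i hi'
    · have hi2 : i = w.length := by
        rw [List.length_append, List.length_singleton] at hi
        omega
      subst hi2
      simpa using hm

theorem extendIndex {c : ℕ → ℕ} {v : List ℕ}
    (hc : ∀ j, k ≤ c j ∧ (c j : ℝ) ≤ stepTop L α j k) (h : IsStepIndex L α k v) (d : ℕ) :
    IsStepIndex L α k (extendIndex c d v) := by
  induction d with
  | zero => exact h
  | succ d ih =>
    rw [extendIndex_succ, snoc_iff, length_extendIndex]
    exact ⟨ih, hc _⟩

theorem extendIndex_const {v : List ℕ} (h : IsStepIndex L α k v) (d : ℕ) :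
    IsStepIndex L α k (_root_.extendIndex (fun _ => k) d v) :=
  h.extendIndex (fun j => ⟨le_rfl, le_stepTop k j⟩) d

theorem extendIndex_top {v : List ℕ} (h : IsStepIndex L α k v) (d : ℕ) :
    IsStepIndex L α k (_root_.extendIndex (fun j => stepTopNat L α j k) d v) :=
  h.extendIndex (fun j => ⟨le_stepTopNat k j, stepTopNat_le k j⟩) d

theorem le_of_snoc {w : List ℕ} {m : ℕ} (h : IsStepIndex L α k (w ++ [m])) :
    k ≤ m ∧ m ≤ stepTopNat L α (w.length + 1) k :=
  ⟨(snoc_iff.1 h).2.1, Nat.le_floor (snoc_iff.1 h).2.2⟩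

theorem snoc_of_le {w : List ℕ} {m : ℕ} (h : IsStepIndex L α k w) (hk : k ≤ m)
    (hm : m ≤ stepTopNat L α (w.length + 1) k) : IsStepIndex L α k (w ++ [m]) :=
  snoc_iff.2 ⟨h, hk, le_trans (by exact_mod_cast hm) (stepTopNat_le k _)⟩

end IsStepIndex

end Index

/-! ### Elementary properties of the steps -/

namespace IsTwistedGluing

variable {L : ℕ} {α : ℝ} {φ : ℕ → ℝ → ℝ} {I : ℕ → List ℕ → Set ℝ} {k : ℕ}

theorem step_basic (h : IsTwistedGluing L α φ I) {w : List ℕ} (hw : IsStepIndex L α k w)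
    (hL : w.length + 2 ≤ L) :
    (I k w).OrdConnected ∧ (I k w).Nontrivial ∧ I k w ⊆ Ioc 0 (2 / 3) := by
  induction w using List.reverseRecOn with
  | nil => exact ⟨(h.first_step k hw.1).1, (h.first_step k hw.1).2.1, (h.first_step k hw.1).2.2.1⟩
  | append_singleton w m ih =>
    rw [List.length_append, List.length_singleton] at hL
    obtain ⟨h1, h2, h3, -⟩ := h.sub_step k w m (by omega) hw
    exact ⟨h1, h2, h3.trans (ih hw.of_append (by omega)).2.2⟩

theorem step_pos (h : IsTwistedGluing L α φ I) {w : List ℕ} (hw : IsStepIndex L α k w)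
    (hL : w.length + 2 ≤ L) : I k w ⊆ Ioi 0 := fun _ hy => ((h.step_basic hw hL).2.2 hy).1

theorem step_nonempty (h : IsTwistedGluing L α φ I) {w : List ℕ} (hw : IsStepIndex L α k w)
    (hL : w.length + 2 ≤ L) : (I k w).Nonempty := (h.step_basic hw hL).2.1.nonempty

theorem step_append_subset (h : IsTwistedGluing L α φ I) {w t : List ℕ}
    (hw : IsStepIndex L α k (w ++ t)) (hL : (w ++ t).length + 2 ≤ L) : I k (w ++ t) ⊆ I k w := by
  induction t using List.reverseRecOn with
  | nil => rw [List.append_nil]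
  | append_singleton t m ih =>
    rw [← List.append_assoc] at hw hL ⊢
    rw [List.length_append, List.length_singleton] at hL
    exact (h.sub_step k _ m (by omega) hw).2.2.1.trans (ih hw.of_append (by omega))

theorem step_extendIndex_subset (h : IsTwistedGluing L α φ I) {c : ℕ → ℕ} {d : ℕ} {v : List ℕ}
    (hw : IsStepIndex L α k (extendIndex c d v)) (hL : v.length + d + 2 ≤ L) :
    I k (extendIndex c d v) ⊆ I k v := by
  obtain ⟨t, ht⟩ := exists_extendIndex_eq_append c d v
  have hl := length_extendIndex c d v
  rw [ht] at hw hl ⊢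
  exact h.step_append_subset hw (by omega)

theorem first_eq (h : IsTwistedGluing L α φ I) {w : List ℕ} (hw : IsStepIndex L α k w)
    (hL : w.length + 2 ≤ L) {y : ℝ} (hy : y ∈ I k w) : φ 0 y = -(k : ℝ) :=
  (h.first_step k hw.1).2.2.2 y
    (h.step_append_subset (w := []) (t := w) (by simpa using hw) (by simpa using hL)
      (by simpa using hy))

theorem succ_eq (h : IsTwistedGluing L α φ I) {w t : List ℕ} {m : ℕ}
    (hw : IsStepIndex L α k (w ++ m :: t)) (hL : (w ++ m :: t).length + 2 ≤ L) {y : ℝ}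
    (hy : y ∈ I k (w ++ m :: t)) : φ (w.length + 1) y = -(m : ℝ) := by
  have he : w ++ m :: t = (w ++ [m]) ++ t := by simp
  rw [he] at hw hL hy
  refine (h.sub_step k w m ?_ hw.of_append).2.2.2 y (h.step_append_subset hw hL hy)
  simp only [List.length_append, List.length_singleton] at hL
  omega

theorem extendIndex_eq (h : IsTwistedGluing L α φ I) {c : ℕ → ℕ} {d : ℕ} {v : List ℕ}
    (hw : IsStepIndex L α k (extendIndex c (d + 1) v)) (hL : v.length + (d + 1) + 2 ≤ L) {y : ℝ}
    (hy : y ∈ I k (extendIndex c (d + 1) v)) :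
    φ (v.length + (d + 1)) y = -(c (v.length + (d + 1)) : ℝ) := by
  rw [extendIndex_succ] at hw hy
  have := h.succ_eq hw (by simp [length_extendIndex]; omega) hy
  rw [length_extendIndex] at this
  exact this

/-- A point determines the indices of the steps that contain it. -/
theorem index_prefix (h : IsTwistedGluing L α φ I) {l : ℕ} {u x : List ℕ}
    (hu : IsStepIndex L α k u) (hx : IsStepIndex L α l x) (hux : u.length ≤ x.length)
    (hL : x.length + 2 ≤ L) {y : ℝ} (hyu : y ∈ I k u) (hyx : y ∈ I l x) :
    l = k ∧ ∃ t, x = u ++ t := by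
  -- The order and every entry of the index are minus the values at `y` of the successive gluing
  -- maps.
  have hlk : l = k := by
    have h1 := h.first_eq hu (by omega) hyu
    have h2 := h.first_eq hx hL hyx
    rw [h1, neg_inj] at h2
    exact_mod_cast h2.symm
  subst hlk
  refine ⟨rfl, ?_⟩
  induction u using List.reverseRecOn with
  | nil => exact ⟨x, rfl⟩
  | append_singleton u m ih =>
    rw [List.length_append, List.length_singleton] at hux
    obtain ⟨t, rfl⟩ := ih (by omega) hu.of_append
      (h.step_append_subset hu (by simp; omega) hyu)
    cases t with
    | nil => simp at hux
    | cons c t =>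
      have h1 := h.succ_eq hx hL hyx
      have h2 := h.succ_eq hu (by simp; omega) hyu
      rw [h1, neg_inj] at h2
      have : c = m := by exact_mod_cast h2
      exact ⟨t, by rw [this]; simp⟩

/-- Since the maps increase on steps and take the values `-m`, small entries lie on the right: the
extension by entries `k` is the rightmost step inside `I k u`. A step with a point to the right of
it has first new entry at most `k`, hence equal to `k`, and one descends a level. -/
theorem eq_extendIndex_const (h : IsTwistedGluing L α φ I) {t u : List ℕ} {y a : ℝ}
    (hw : IsStepIndex L α k (u ++ t)) (hL : (u ++ t).length + 2 ≤ L) (hy : y ∈ I k (u ++ t))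
    (ha : a ∈ I k (extendIndex (fun _ => k) t.length u)) (hay : a ≤ y) :
    u ++ t = extendIndex (fun _ => k) t.length u := by
  induction t generalizing u with
  | nil => simp [extendIndex]
  | cons m t ih =>
    have hu : IsStepIndex L α k u := hw.of_append
    have hlen : u.length + (t.length + 1) + 2 ≤ L := by simpa using hL
    have hau : a ∈ I k u := h.step_extendIndex_subset (hu.extendIndex_const _) hlen ha
    have hyu : y ∈ I k u := h.step_append_subset hw hL hy
    have hm := h.step_mono k u (by omega) hu hau hyu hay
    have he : u ++ m :: t = (u ++ [m]) ++ t := by simp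
    have hw1 := hw
    rw [he] at hw1
    have hkm := hw1.of_append.le_of_snoc.1
    have hak : φ (u.length + 1) a = -(k : ℝ) := by
      have ha' : a ∈ I k (u ++ [k]) := by
        refine h.step_extendIndex_subset (c := fun _ => k) (d := t.length)
          (hu.extendIndex_const (t.length + 1)) (by simp; omega) ha
      exact h.succ_eq (t := []) (hu.extendIndex_const 1) (by simp; omega) ha'
    rw [hak, h.succ_eq hw hL hy, neg_le_neg_iff] at hm
    have hm' : m = k := le_antisymm (by exact_mod_cast hm) hkm
    subst hm'
    have := ih (u := u ++ [m]) hw1 (by rwa [he] at hL) (by rwa [he] at hy) ha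
    rw [he, this]
    rfl

/-- Mirror image of `eq_extendIndex_const`: the largest admissible entries give the leftmost step.
-/
theorem eq_extendIndex_top (h : IsTwistedGluing L α φ I) {t u : List ℕ} {y b : ℝ}
    (hw : IsStepIndex L α k (u ++ t)) (hL : (u ++ t).length + 2 ≤ L) (hy : y ∈ I k (u ++ t))
    (hb : b ∈ I k (extendIndex (fun j => stepTopNat L α j k) t.length u)) (hyb : y ≤ b) :
    u ++ t = extendIndex (fun j => stepTopNat L α j k) t.length u := by
  induction t generalizing u with
  | nil => simp [extendIndex]
  | cons m t ih =>
    have hu : IsStepIndex L α k u := hw.of_append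
    have hlen : u.length + (t.length + 1) + 2 ≤ L := by simpa using hL
    have hbu : b ∈ I k u := h.step_extendIndex_subset (hu.extendIndex_top _) hlen hb
    have hyu : y ∈ I k u := h.step_append_subset hw hL hy
    have hm := h.step_mono k u (by omega) hu hyu hbu hyb
    have he : u ++ m :: t = (u ++ [m]) ++ t := by simp
    have hw1 := hw
    rw [he] at hw1
    have hkm := hw1.of_append.le_of_snoc.2
    have hbk : φ (u.length + 1) b = -(stepTopNat L α (u.length + 1) k : ℝ) := by
      have hb' : b ∈ I k (u ++ [stepTopNat L α (u.length + 1) k]) := by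
        refine h.step_extendIndex_subset (c := fun j => stepTopNat L α j k) (d := t.length)
          (hu.extendIndex_top (t.length + 1)) (by simp; omega) hb
      exact h.succ_eq (t := []) (hu.extendIndex_top 1) (by simp; omega) hb'
    rw [hbk, h.succ_eq hw hL hy, neg_le_neg_iff] at hm
    have hm' : m = stepTopNat L α (u.length + 1) k := le_antisymm hkm (by exact_mod_cast hm)
    subst hm'
    have := ih (u := u ++ [stepTopNat L α (u.length + 1) k]) hw1 (by rwa [he] at hL)
      (by rwa [he] at hy) hb
    rw [he, this]
    rfl

/-- Variation across the gap between two successive steps of the same order that differ at the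
level of `u`, below the last level. -/
theorem floorVariationLE_gap (h : IsTwistedGluing L α φ I) {u : List ℕ} {m d : ℕ}
    (hu : IsStepIndex L α k (u ++ [m + 1])) (hu' : IsStepIndex L α k (u ++ [m]))
    (hL : u.length + 1 + (d + 1) + 2 ≤ L) {a b : ℝ}
    (ha : a ∈ I k (extendIndex (fun _ => k) (d + 1) (u ++ [m + 1])))
    (hb : b ∈ I k (extendIndex (fun j => stepTopNat L α j k) (d + 1) (u ++ [m]))) :
    FloorVariationLE (φ (u.length + 1 + (d + 1))) k
      (stepTopNat L α (u.length + 1 + (d + 1)) k - k) (Icc a b) := by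
  have hk := hu.1
  have hA := hu.extendIndex_const (d + 1)
  have hB := hu'.extendIndex_top (d + 1)
  have hl1 : (u ++ [m + 1]).length = u.length + 1 := by simp
  have hl2 : (u ++ [m]).length = u.length + 1 := by simp
  have hAl := length_extendIndex (fun _ => k) (d + 1) (u ++ [m + 1])
  have hBl := length_extendIndex (fun j => stepTopNat L α j k) (d + 1) (u ++ [m])
  rw [hl1] at hAl
  rw [hl2] at hBl
  set A := extendIndex (fun _ => k) (d + 1) (u ++ [m + 1]) with hAdef
  set B := extendIndex (fun j => stepTopNat L α j k) (d + 1) (u ++ [m]) with hBdef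
  have subA : I k A ⊆ I k (u ++ [m + 1]) := h.step_extendIndex_subset hA (by omega)
  have subB : I k B ⊆ I k (u ++ [m]) := h.step_extendIndex_subset hB (by omega)
  have subA' : I k A ⊆ I k u := subA.trans (h.step_append_subset hu (by omega))
  have subB' : I k B ⊆ I k u := subB.trans (h.step_append_subset hu' (by omega))
  have valA : ∀ y ∈ I k A, φ (u.length + 1) y = -((m + 1 : ℕ) : ℝ) := fun y hy =>
    h.succ_eq (t := []) hu (by omega) (subA hy)
  have valB : ∀ y ∈ I k B, φ (u.length + 1) y = -(m : ℝ) := fun y hy =>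
    h.succ_eq (t := []) hu' (by omega) (subB hy)
  have hmono := h.step_mono k u (by omega) hu.of_append
  have hlt : SetLT (I k A) (I k B) := by
    intro x hx z hz
    by_contra! hc
    have := hmono (subB' hz) (subA' hx) hc
    rw [valA x hx, valB z hz] at this
    push_cast at this
    linarith
  -- A step in between would lie in `I k u`, with next entry `m + 1` or `m` by monotonicity. It
  -- would then be to the right of the rightmost step under `m + 1`, or to the left of the leftmost
  -- one under `m`, hence equal to `A` or `B`.
  have hsucc : ¬ ∃ (l : ℕ) (v : List ℕ), v.length = u.length + 1 + (d + 1) ∧ IsStepIndex L α l v ∧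
      SetLT (I k A) (I l v) ∧ SetLT (I l v) (I k B) := by
    rintro ⟨l, x, hxl, hx, hAx, hxB⟩
    obtain ⟨y, hy⟩ := h.step_nonempty hx (by omega)
    have hay := hAx a ha y hy
    have hyb := hxB y hy b hb
    have hyu : y ∈ I k u := (h.step_basic hu.of_append (by omega)).1.out (subA' ha) (subB' hb)
      ⟨hay.le, hyb.le⟩
    obtain ⟨rfl, t, rfl⟩ := h.index_prefix hu.of_append hx (by omega) (by omega) hyu hy
    cases t with
    | nil => simp at hxl; omega
    | cons c t =>
      have hval := h.succ_eq hx (by omega) hy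
      have h1 := hmono (subA' ha) hyu hay.le
      have h2 := hmono hyu (subB' hb) hyb.le
      rw [hval, valA a ha, neg_le_neg_iff] at h1
      rw [hval, valB b hb, neg_le_neg_iff] at h2
      have h1' : c ≤ m + 1 := by exact_mod_cast h1
      have h2' : m ≤ c := by exact_mod_cast h2
      have htl : t.length = d + 1 := by simp at hxl; omega
      have he : u ++ c :: t = (u ++ [c]) ++ t := by simp
      rw [he] at hx hy hxl hAx hxB
      rcases (by omega : c = m + 1 ∨ c = m) with rfl | rfl
      · have := h.eq_extendIndex_const hx (by omega) hy (by rwa [htl]) hay.le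
        rw [htl, ← hAdef] at this
        rw [this] at hAx hy
        exact lt_irrefl _ (hAx y hy y hy)
      · have := h.eq_extendIndex_top hx (by omega) hy (by rwa [htl]) hyb.le
        rw [htl, ← hBdef] at this
        rw [this] at hxB hy
        exact lt_irrefl _ (hxB y hy y hy)
  have hT := le_stepTopNat (L := L) (α := α) k (u.length + 1 + (d + 1))
  refine FloorVariationLE.of_gapBetween (h.continuousOn _ (by omega)) (h.step_pos hA (by omega))
    (h.step_basic hA (by omega)).1 (h.step_basic hB (by omega)).1 ha hb hlt
    (p := k) (q := stepTopNat L α (u.length + 1 + (d + 1)) k) (fun y hy => ?_) (fun y hy => ?_)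
    (h.monotone_between _ (by omega) (by omega) k A k B hAl hBl hA hB hlt hsucc)
    le_rfl hT (by omega) (by omega)
  · have := h.extendIndex_eq hA (by omega) hy
    rwa [hl1] at this
  · have := h.extendIndex_eq hB (by omega) hy
    rwa [hl2] at this

/-- Variation across the gap between the steps of order `k + 1` and those of order `k`. -/
theorem floorVariationLE_gap_order (h : IsTwistedGluing L α φ I) {d : ℕ} (hk : 1 ≤ k)
    (hL : (d + 1) + 2 ≤ L) {a b : ℝ}
    (ha : a ∈ I (k + 1) (extendIndex (fun _ => k + 1) (d + 1) []))
    (hb : b ∈ I k (extendIndex (fun j => stepTopNat L α j k) (d + 1) [])) :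
    FloorVariationLE (φ (d + 1)) k (stepTopNat L α (d + 1) k - k + 1) (Icc a b) := by
  have hA := (IsStepIndex.nil (L := L) (α := α) (show 1 ≤ k + 1 by omega)).extendIndex_const (d + 1)
  have hB := (IsStepIndex.nil (L := L) (α := α) hk).extendIndex_top (d + 1)
  have hAl := length_extendIndex (fun _ => k + 1) (d + 1) []
  have hBl := length_extendIndex (fun j => stepTopNat L α j k) (d + 1) []
  rw [List.length_nil, zero_add] at hAl hBl
  set A := extendIndex (fun _ => k + 1) (d + 1) [] with hAdef
  set B := extendIndex (fun j => stepTopNat L α j k) (d + 1) [] with hBdef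
  have posA := h.step_pos hA (by omega)
  have posB := h.step_pos hB (by omega)
  have valA : ∀ y ∈ I (k + 1) A, φ 0 y = -((k + 1 : ℕ) : ℝ) := fun y hy =>
    h.first_eq hA (by omega) hy
  have valB : ∀ y ∈ I k B, φ 0 y = -(k : ℝ) := fun y hy => h.first_eq hB (by omega) hy
  have hlt : SetLT (I (k + 1) A) (I k B) := by
    intro x hx z hz
    by_contra! hc
    have := h.first_mono (posB hz) (posA hx) hc
    rw [valA x hx, valB z hz] at this
    push_cast at this
    linarith
  have hsucc : ¬ ∃ (l : ℕ) (v : List ℕ), v.length = d + 1 ∧ IsStepIndex L α l v ∧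
      SetLT (I (k + 1) A) (I l v) ∧ SetLT (I l v) (I k B) := by
    rintro ⟨l, x, hxl, hx, hAx, hxB⟩
    obtain ⟨y, hy⟩ := h.step_nonempty hx (by omega)
    have hay := hAx a ha y hy
    have hyb := hxB y hy b hb
    have hy0 := h.step_pos hx (by omega) hy
    have hval := h.first_eq hx (by omega) hy
    have h1 := h.first_mono (posA ha) hy0 hay.le
    have h2 := h.first_mono hy0 (posB hb) hyb.le
    rw [hval, valA a ha, neg_le_neg_iff] at h1
    rw [hval, valB b hb, neg_le_neg_iff] at h2
    have h1' : l ≤ k + 1 := by exact_mod_cast h1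
    have h2' : k ≤ l := by exact_mod_cast h2
    rcases (by omega : l = k + 1 ∨ l = k) with rfl | rfl
    · have := h.eq_extendIndex_const (u := []) (t := x) hx (by simpa using (by omega)) hy
        (by rwa [hxl]) hay.le
      rw [hxl, ← hAdef, List.nil_append] at this
      rw [this] at hAx hy
      exact lt_irrefl _ (hAx y hy y hy)
    · have := h.eq_extendIndex_top (u := []) (t := x) hx (by simpa using (by omega)) hy
        (by rwa [hxl]) hyb.le
      rw [hxl, ← hBdef, List.nil_append] at this
      rw [this] at hxB hy
      exact lt_irrefl _ (hxB y hy y hy)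
  have hT := le_stepTopNat (L := L) (α := α) k (d + 1)
  -- The order drops by one across this gap, so the left value is `-(k + 1)`; this is the origin of
  -- the extra `1` in the bound.
  refine FloorVariationLE.of_gapBetween (h.continuousOn _ (by omega)) posA
    (h.step_basic hA (by omega)).1 (h.step_basic hB (by omega)).1 ha hb hlt
    (p := k + 1) (q := stepTopNat L α (d + 1) k) (fun y hy => ?_) (fun y hy => ?_)
    (h.monotone_between _ (by omega) (by omega) (k + 1) A k B hAl hBl hA hB hlt hsucc)
    (by omega) hT (by omega) (by omega)
  · have := h.extendIndex_eq hA (by simp; omega) hy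
    simpa using this
  · have := h.extendIndex_eq hB (by simp; omega) hy
    simpa using this

end IsTwistedGluing

/-! ### Variation of the gluing maps -/

/-- A bound for the variation of a gluing map on a step `d` levels above its own steps, where `k` is
the order of the step and `r` the oscillation of the gluing map. -/
def stepVariation (k r : ℕ) : ℕ → ℕ
  | 0 => 0
  | 1 => r
  | d + 2 => (k + 1) * (stepVariation k r (d + 1) + r)

theorem stepVariation_le (k r d : ℕ) :
    stepVariation k r (d + 1) ≤ (d + 1) * (k + 1) ^ d * r := by
  induction d with
  | zero => simp [stepVariation]
  | succ d ih =>
    rw [stepVariation]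
    have h1 : 1 ≤ (k + 1) ^ d := Nat.one_le_pow _ _ (by omega)
    calc (k + 1) * (stepVariation k r (d + 1) + r)
        ≤ (k + 1) * ((d + 1) * (k + 1) ^ d * r + (k + 1) ^ d * r) := by
          gcongr
          nlinarith
      _ = (d + 1 + 1) * (k + 1) ^ (d + 1) * r := by ring

namespace IsTwistedGluing

variable {L : ℕ} {α : ℝ} {φ : ℕ → ℝ → ℝ} {I : ℕ → List ℕ → Set ℝ} {k : ℕ}

/-- Here `a` lies in the leftmost and `b` in the rightmost step of `φ j` inside `I k v`. One level
above its steps, `φ j` is increasing from `a` to `b`. Higher up, the substeps are crossed from left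
to right, each crossing and each gap being estimated separately. -/
theorem floorVariationLE_step (h : IsTwistedGluing L α φ I) (hα : α ≤ L) {d : ℕ} {v : List ℕ}
    (hv : IsStepIndex L α k v) {j : ℕ} (hj : v.length + d = j) (hj1 : 1 ≤ j) (hL : j + 2 ≤ L)
    {a b : ℝ} (ha : a ∈ I k (extendIndex (fun j => stepTopNat L α j k) d v))
    (hb : b ∈ I k (extendIndex (fun _ => k) d v)) :
    FloorVariationLE (φ j) k (stepVariation k (stepTopNat L α j k - k) d) (Icc a b) := by
  subst hj
  induction d generalizing v a b with
  | zero =>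
    simp only [extendIndex] at ha hb
    rw [add_zero] at hL ⊢ hj1
    cases v using List.reverseRecOn with
    | nil => simp at hj1
    | append_singleton u m =>
      refine FloorVariationLE.of_const hv.le_of_snoc.1 fun y hy => ?_
      have := h.succ_eq (t := []) hv hL ((h.step_basic hv hL).1.out ha hb hy)
      simpa using this
  | succ d ih =>
    have hAi := hv.extendIndex_top (d + 1)
    have hBi := hv.extendIndex_const (d + 1)
    cases d with
    | zero =>
      have hav := h.step_extendIndex_subset hAi (by omega) ha
      have hbv := h.step_extendIndex_subset hBi (by omega) hb
      have hT := le_stepTopNat (L := L) (α := α) k (v.length + 1)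
      exact FloorVariationLE.of_monotoneOn
        ((h.step_mono k v (by omega) hv).mono ((h.step_basic hv (by omega)).1.out hav hbv))
        (h.extendIndex_eq hAi hL ha) (h.extendIndex_eq hBi hL hb) le_rfl
        (by rw [stepVariation, zero_add]; omega)
    | succ d =>
      have hj : v.length + (d + 1 + 1) = v.length + 1 + (d + 1) := by omega
      set r := stepTopNat L α (v.length + (d + 1 + 1)) k - k with hr
      set H := stepVariation k r (d + 1) with hH
      have hT := le_stepTopNat (L := L) (α := α) k (v.length + 1)
      have hT2 := stepTopNat_le_two_mul hα hv.1 (v.length + 1)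
      have hsub : ∀ m, k ≤ m → m ≤ stepTopNat L α (v.length + 1) k → ∀ a b,
          a ∈ I k (extendIndex (fun j => stepTopNat L α j k) (d + 1) (v ++ [m])) →
          b ∈ I k (extendIndex (fun _ => k) (d + 1) (v ++ [m])) →
          FloorVariationLE (φ (v.length + (d + 1 + 1))) k H (Icc a b) := by
        intro m hm hm' a b ha hb
        have := ih (hv.snoc_of_le hm hm') ha hb (by simp; omega) (by simp; omega)
        rw [List.length_append, List.length_singleton, ← hj] at this
        exact this
      -- Crossing the substeps with entries `k + n, …, k` meets `n + 1` substeps of variation `H`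
      -- and `n` gaps of variation `r`.
      have key : ∀ n, k + n ≤ stepTopNat L α (v.length + 1) k → ∀ a,
          a ∈ I k (extendIndex (fun j => stepTopNat L α j k) (d + 1) (v ++ [k + n])) →
          FloorVariationLE (φ (v.length + (d + 1 + 1))) k (n * (H + r) + H) (Icc a b) := by
        intro n
        induction n with
        | zero =>
          intro hn a ha
          rw [zero_mul, zero_add]
          exact hsub k le_rfl hn a b ha hb
        | succ n ihn =>
          intro hn a ha
          have i1 : IsStepIndex L α k (v ++ [k + n + 1]) := hv.snoc_of_le (by omega) (by omega)
          have i2 : IsStepIndex L α k (v ++ [k + n]) := hv.snoc_of_le (by omega) (by omega)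
          obtain ⟨b', hb'⟩ := h.step_nonempty (i1.extendIndex_const (d + 1))
            (by rw [length_extendIndex]; simp; omega)
          obtain ⟨a', ha'⟩ := h.step_nonempty (i2.extendIndex_top (d + 1))
            (by rw [length_extendIndex]; simp; omega)
          have g1 := hsub (k + n + 1) (by omega) hn a b' ha hb'
          have g2 := h.floorVariationLE_gap i1 i2 (by omega) hb' ha'
          rw [← hj] at g2
          have g3 := ihn (by omega) a' ha'
          exact ((g1.trans g2).trans g3).mono (by rw [← hr]; apply le_of_eq; ring) subset_rfl
      -- As the entries are at most `2 * k`, there are at most `k` gaps and `k + 1` substeps.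
      have := key (stepTopNat L α (v.length + 1) k - k) (by omega) a
        (by rwa [Nat.add_sub_cancel' hT])
      refine this.mono ?_ subset_rfl
      rw [stepVariation]
      calc _ ≤ k * (H + r) + (H + r) := by gcongr <;> omega
        _ = _ := by ring

/-- The points `e k` of steps of order `k` with minimal index. -/
theorem exists_minimal_points (h : IsTwistedGluing L α φ I) (hL : 2 ≤ L) :
    ∃ e : ℕ → ℝ, ∀ k, 1 ≤ k → ∀ j, j + 2 ≤ L → e k ∈ I k (extendIndex (fun _ => k) j []) := by
  -- A point at the deepest level `L - 2` lies in the minimal steps of all the gluing maps at once.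
  have : ∀ k : ℕ, ∃ y, 1 ≤ k → y ∈ I k (extendIndex (fun _ => k) (L - 2) []) := by
    intro k
    by_cases hk : 1 ≤ k
    · obtain ⟨y, hy⟩ := h.step_nonempty ((IsStepIndex.nil (L := L) (α := α) hk).extendIndex_const
        (L - 2)) (by rw [length_extendIndex]; simp; omega)
      exact ⟨y, fun _ => hy⟩
    · exact ⟨0, fun h => absurd h hk⟩
  choose e he using this
  refine ⟨e, fun k hk j hj => ?_⟩
  have h1 := he k hk
  have hi := (IsStepIndex.nil (L := L) (α := α) hk).extendIndex_const (L - 2)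
  rw [show L - 2 = j + (L - 2 - j) by omega, extendIndex_add] at h1 hi
  exact h.step_extendIndex_subset hi (by rw [length_extendIndex]; simp; omega) h1

end IsTwistedGluing

/-- A bound for the variation of `φ j` between steps of orders `k + 1` and `k`. -/
noncomputable def orderVariation (L : ℕ) (α : ℝ) (j k : ℕ) : ℕ :=
  if j = 0 then 1
  else stepTopNat L α j k - k + 1 + stepVariation k (stepTopNat L α j k - k) j

/-- The factor `N + 1` bounds the number of orders `k < N` over which this estimate is summed. The
last gluing map gives exactly the exponent `L - 2 + α' = α - 1`; the earlier ones give at most `L -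
2`, which is smaller. -/
theorem mul_orderVariation_le {L : ℕ} {α : ℝ} (hL : 3 ≤ L) (hα : α ∈ Ioc ((L : ℝ) - 1) L)
    {j k N : ℕ} (hj : j + 2 ≤ L) (hk : 1 ≤ k) (hkN : k < N) :
    ((N : ℝ) + 1) * orderVariation L α j k ≤ L * ((N : ℝ) + 1) ^ (α - 1) := by
  set M : ℝ := (N : ℝ) + 1 with hM
  have hM1 : 1 ≤ M := by rw [hM]; linarith [(Nat.cast_nonneg N : (0 : ℝ) ≤ N)]
  have hM0 : 0 < M := by linarith
  have hkM : (k : ℝ) + 1 ≤ M := by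
    have : (k : ℝ) + 1 ≤ N := by exact_mod_cast hkN
    linarith
  have hL3 : (3 : ℝ) ≤ L := by exact_mod_cast hL
  rcases Nat.eq_zero_or_pos j with rfl | hj0
  · have h1 : M ^ (1 : ℝ) ≤ M ^ (α - 1) :=
      Real.rpow_le_rpow_of_exponent_le hM1 (by linarith [hα.1])
    rw [Real.rpow_one] at h1
    simp only [orderVariation, if_true, Nat.cast_one, mul_one]
    nlinarith
  obtain ⟨d, rfl⟩ : ∃ d, j = d + 1 := ⟨j - 1, by omega⟩
  set r := stepTopNat L α (d + 1) k - k with hr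
  -- `ρ` is a real bound for the oscillation `r`: `M ^ (α - L + 1)` for the last gluing map, `M` for
  -- the others.
  obtain ⟨ρ, hρ1, hrρ, hρ⟩ : ∃ ρ : ℝ, 1 ≤ ρ ∧ (r : ℝ) ≤ ρ ∧ ρ * M ^ (d + 1) ≤ M ^ (α - 1) := by
    have hT := le_stepTopNat (L := L) (α := α) k (d + 1)
    rcases eq_or_lt_of_le hj with hjL | hjL
    · refine ⟨M ^ (α - L + 1), Real.one_le_rpow hM1 (by linarith [hα.1]), ?_, ?_⟩
      · have h1 := stepTopNat_le (L := L) (α := α) k (d + 1)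
        rw [stepTop, if_pos hjL] at h1
        rw [hr, Nat.cast_sub hT]
        have h2 : (k : ℝ) ^ (α - L + 1) ≤ M ^ (α - L + 1) :=
          Real.rpow_le_rpow (Nat.cast_nonneg k) (by linarith) (by linarith [hα.1])
        linarith
      · rw [← Real.rpow_natCast, ← Real.rpow_add hM0]
        apply le_of_eq
        congr 1
        have : ((d + 1 + 2 : ℕ) : ℝ) = L := by exact_mod_cast hjL
        push_cast at this ⊢
        linarith
    · refine ⟨M, hM1, ?_, ?_⟩
      · have h1 := stepTopNat_le_two_mul hα.2 hk (d + 1)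
        have h2 : r ≤ k := by omega
        have : (r : ℝ) ≤ k := by exact_mod_cast h2
        linarith
      · rw [← pow_succ', ← Real.rpow_natCast]
        apply Real.rpow_le_rpow_of_exponent_le hM1
        have : ((d + 1 + 2 + 1 : ℕ) : ℝ) ≤ L := by exact_mod_cast hjL
        push_cast at this ⊢
        linarith [hα.1]
  have h1 : (stepVariation k r (d + 1) : ℝ) ≤ (d + 1) * M ^ d * ρ := by
    have h2 : (stepVariation k r (d + 1) : ℝ) ≤ ((d + 1) * (k + 1) ^ d * r : ℕ) := by
      exact_mod_cast stepVariation_le k r d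
    refine h2.trans ?_
    push_cast
    gcongr
  have hd : (1 : ℝ) ≤ M ^ d := one_le_pow₀ hM1
  have hdL : ((d + 3 : ℕ) : ℝ) ≤ L := by exact_mod_cast hj
  push_cast at hdL
  have h3 : (orderVariation L α (d + 1) k : ℝ) ≤ (d + 3) * M ^ d * ρ := by
    rw [orderVariation, if_neg (by omega), ← hr]
    push_cast
    have : ρ ≤ M ^ d * ρ := le_mul_of_one_le_left (by linarith) hd
    linarith
  calc M * orderVariation L α (d + 1) k ≤ M * ((d + 3) * M ^ d * ρ) := by gcongr
    _ = (d + 3) * (ρ * M ^ (d + 1)) := by ring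
    _ ≤ L * M ^ (α - 1) := by gcongr

namespace IsTwistedGluing

variable {L : ℕ} {α : ℝ} {φ : ℕ → ℝ → ℝ} {I : ℕ → List ℕ → Set ℝ}

/-- The points `e N` tend to `0`, every gluing map is at most `-N` on `(0, e N]`, and the integer
parts of the gluing maps take together at most about `N ^ (α - 1)` values on `[e N, e 1]`. -/
theorem exists_order_points (h : IsTwistedGluing L α φ I) (hL : 3 ≤ L)
    (hα : α ∈ Ioc ((L : ℝ) - 1) L) :
    ∃ e : ℕ → ℝ, (∀ N, 1 ≤ N → 0 < e N) ∧
      (∀ N, 1 ≤ N → ∀ j, j + 1 < L → ∀ y ∈ Ioc 0 (e N), φ j y ≤ -(N : ℝ)) ∧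
      ∀ N, 1 ≤ N → ((fun y (j : Fin (L - 1)) => ⌊φ j y⌋) '' Icc (e N) (e 1)).Finite ∧
        (((fun y (j : Fin (L - 1)) => ⌊φ j y⌋) '' Icc (e N) (e 1)).ncard : ℝ)
          ≤ ((L : ℝ) ^ 2 + 1) * ((N : ℝ) + 1) ^ (α - 1) := by
  obtain ⟨e, he⟩ := h.exists_minimal_points (by omega)
  have he0 : ∀ k, 1 ≤ k → e k ∈ I k [] := fun k hk => he k hk 0 (by omega)
  have hpos : ∀ k, 1 ≤ k → 0 < e k := fun k hk =>
    h.step_pos (IsStepIndex.nil (L := L) (α := α) hk) (by simp; omega) (he0 k hk)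
  have hval : ∀ k, 1 ≤ k → φ 0 (e k) = -(k : ℝ) := fun k hk =>
    h.first_eq (IsStepIndex.nil (L := L) (α := α) hk) (by simp; omega) (he0 k hk)
  have hstep : ∀ j, j + 2 ≤ L → ∀ k, 1 ≤ k →
      FloorVariationLE (φ j) k (orderVariation L α j k) (Icc (e (k + 1)) (e k)) := by
    intro j hj k hk
    cases j with
    | zero =>
      refine FloorVariationLE.of_monotoneOn (h.first_mono.mono ?_) (hval (k + 1) (by omega))
        (hval k hk) le_rfl (by simp [orderVariation])
      exact fun y hy => lt_of_lt_of_le (hpos (k + 1) (by omega)) hy.1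
    | succ d =>
      have hn := IsStepIndex.nil (L := L) (α := α) hk
      obtain ⟨b, hb⟩ := h.step_nonempty (hn.extendIndex_top (d + 1))
        (by rw [length_extendIndex]; simp; omega)
      have g1 := h.floorVariationLE_gap_order hk hj (he (k + 1) (by omega) _ hj) hb
      have g2 := h.floorVariationLE_step hα.2 hn (j := d + 1) (by simp) (by omega) hj hb
        (he k hk _ hj)
      refine (g1.trans g2).mono ?_ subset_rfl
      rw [orderVariation, if_neg (by omega)]
  have hsum : ∀ j, j + 2 ≤ L → ∀ N, 1 ≤ N →
      FloorVariationLE (φ j) 1 (∑ k ∈ Finset.Ico 1 N, orderVariation L α j k)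
        (Icc (e N) (e 1)) := by
    intro j hj N hN
    induction N, hN using Nat.le_induction with
    | base =>
      rw [Icc_self, Finset.Ico_self, Finset.sum_empty]
      refine ⟨by rw [eVariationOn.subsingleton _ subsingleton_singleton]; exact zero_le, ?_⟩
      have := (hstep j hj 1 le_rfl).2
      rintro _ rfl
      refine this _ ⟨?_, le_rfl⟩
      by_contra! hc
      have := h.first_mono (mem_Ioi.2 (hpos 1 le_rfl)) (mem_Ioi.2 (hpos 2 (by omega))) hc.le
      rw [hval 1 le_rfl, hval 2 (by omega)] at this
      norm_num at this
    | succ N hN ih =>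
      have h1 := hstep j hj N hN
      have h1' : FloorVariationLE (φ j) 1 (orderVariation L α j N) (Icc (e (N + 1)) (e N)) :=
        ⟨h1.1, fun y hy => (h1.2 y hy).trans (neg_le_neg (by exact_mod_cast hN))⟩
      exact (h1'.trans ih).mono (by rw [Finset.sum_Ico_succ_top hN, add_comm]) subset_rfl
  refine ⟨e, hpos, ?_, ?_⟩
  · intro N hN j hj y hy
    obtain ⟨K, hK⟩ := ((h.first_tendsto y hy.1).and (eventually_ge_atTop (N + 1))).exists
    have heK : e K < y := (hK.1 (he0 K (by omega))).2
    -- The first `e (N + n)` to the left of `y` places `y` between points of consecutive orders, the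
    -- smaller of which is at least `N`.
    have hex : ∃ n, e (N + n) < y := ⟨K - N, by rwa [Nat.add_sub_cancel' (by omega)]⟩
    classical
    set n := Nat.find hex with hn
    have hn1 : e (N + n) < y := Nat.find_spec hex
    have hn0 : n ≠ 0 := by
      intro h0
      rw [h0] at hn1
      exact absurd hy.2 (not_le.2 hn1)
    obtain ⟨m, hm⟩ := Nat.exists_eq_succ_of_ne_zero hn0
    have hm1 : y ≤ e (N + m) := not_lt.1 (Nat.find_min hex (by omega))
    have := (hstep j (by omega) (N + m) (by omega)).2 y
      ⟨by rw [hm] at hn1; exact hn1.le, hm1⟩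
    push_cast at this
    linarith [(Nat.cast_nonneg m : (0 : ℝ) ≤ m)]
  · intro N hN
    set M : ℝ := (N : ℝ) + 1 with hM
    have hM1 : 1 ≤ M := by rw [hM]; linarith [(Nat.cast_nonneg N : (0 : ℝ) ≤ N)]
    have hpow : 1 ≤ M ^ (α - 1) := by
      have hL3 : (3 : ℝ) ≤ L := by exact_mod_cast hL
      exact Real.one_le_rpow hM1 (by linarith [hα.1])
    obtain ⟨hfin, hcard⟩ := ncard_image_le_of_sum_eVariationOn_le
      (fun y (j : Fin (L - 1)) => ⌊φ j y⌋) (Icc (e N) (e 1))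
      (∑ j : Fin (L - 1), ∑ k ∈ Finset.Ico 1 N, orderVariation L α j k) (by
        push_cast
        refine Finset.sum_le_sum fun j _ => ?_
        have := (hsum j (by omega) N hN).1
        push_cast at this
        exact this)
    refine ⟨hfin, ?_⟩
    have hone : ∀ j : Fin (L - 1),
        ((∑ k ∈ Finset.Ico 1 N, orderVariation L α j k : ℕ) : ℝ) ≤ L * M ^ (α - 1) := by
      intro j
      have h1 : M * ((∑ k ∈ Finset.Ico 1 N, orderVariation L α j k : ℕ) : ℝ)
          ≤ M * (L * M ^ (α - 1)) := by
        push_cast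
        rw [Finset.mul_sum]
        refine (Finset.sum_le_card_nsmul _ _ (L * M ^ (α - 1)) fun k hk => ?_).trans ?_
        · rw [Finset.mem_Ico] at hk
          exact mul_orderVariation_le hL hα (by omega) hk.1 hk.2
        · rw [nsmul_eq_mul, Nat.card_Ico]
          gcongr
          rw [hM, Nat.cast_sub hN]
          push_cast
          linarith
      exact le_of_mul_le_mul_left h1 (by linarith)
    calc _ ≤ (((∑ j : Fin (L - 1), ∑ k ∈ Finset.Ico 1 N, orderVariation L α j k) + 1 : ℕ) : ℝ) := by
          exact_mod_cast hcard
      _ = ∑ j : Fin (L - 1), ((∑ k ∈ Finset.Ico 1 N, orderVariation L α j k : ℕ) : ℝ) + 1 := by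
          push_cast; rfl
      _ ≤ ∑ _j : Fin (L - 1), (L * M ^ (α - 1)) + 1 := by gcongr with j _; exact hone j
      _ = ((L - 1 : ℕ) : ℝ) * (L * M ^ (α - 1)) + 1 := by simp
      _ ≤ L * (L * M ^ (α - 1)) + M ^ (α - 1) := by gcongr; omega
      _ = _ := by ring

end IsTwistedGluing

/-! ### Words supported near prescribed times -/

section Words

variable {X : Type*} {L : ℕ}

/-- There are boundedly many words whose letters differ from the letter at infinity only near one of
`L` prescribed times. -/
theorem ncard_words_le (F : Set (Set X)) (hF : F.Finite) (hFL : F.ncard ≤ L) (n C : ℕ)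
    (τ : Fin L → ℤ) :
    {w : Fin n → Set X | (∀ k, w k ∈ insert (⋃₀ F)ᶜ F) ∧
        ∀ k : Fin n, w k ≠ (⋃₀ F)ᶜ → ∃ i, |(k : ℤ) - τ i| ≤ C}.Finite ∧
      {w : Fin n → Set X | (∀ k, w k ∈ insert (⋃₀ F)ᶜ F) ∧
        ∀ k : Fin n, w k ≠ (⋃₀ F)ᶜ → ∃ i, |(k : ℤ) - τ i| ≤ C}.ncard
        ≤ (L + 1) ^ (L * (2 * C + 1)) := by
  classical
  have hfin : (insert (⋃₀ F)ᶜ F).Finite := hF.insert _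
  set A : Finset (Set X) := hfin.toFinset with hA
  have hAcard : A.card ≤ L + 1 := by
    rw [hA, ← ncard_eq_toFinset_card _ hfin]
    exact (ncard_insert_le _ _).trans (by omega)
  set near : Fin n → Prop := fun k => ∃ i, |(k : ℤ) - τ i| ≤ C with hnear
  set B : Finset (Fin n → Set X) :=
    Fintype.piFinset fun k => if near k then A else {(⋃₀ F)ᶜ} with hB
  have hsub : {w : Fin n → Set X | (∀ k, w k ∈ insert (⋃₀ F)ᶜ F) ∧
        ∀ k : Fin n, w k ≠ (⋃₀ F)ᶜ → ∃ i, |(k : ℤ) - τ i| ≤ C} ⊆ (B : Set (Fin n → Set X)) := by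
    rintro w ⟨h1, h2⟩
    rw [Finset.mem_coe, hB, Fintype.mem_piFinset]
    intro k
    split_ifs with hk
    · exact (Set.Finite.mem_toFinset hfin).2 (h1 k)
    · rw [Finset.mem_singleton]
      by_contra hc
      exact hk (h2 k hc)
  have hnearcard : (Finset.univ.filter near).card ≤ L * (2 * C + 1) := by
    have h1 : ((Finset.univ.filter near).map
        ⟨fun k : Fin n => (k : ℤ), fun a b hab => by
          simp only [Nat.cast_inj] at hab
          exact Fin.ext hab⟩) ⊆
        Finset.univ.biUnion fun i => Finset.Icc (τ i - C) (τ i + C) := by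
      intro z hz
      rw [Finset.mem_map] at hz
      obtain ⟨k, hk, rfl⟩ := hz
      obtain ⟨i, hi⟩ := (Finset.mem_filter.1 hk).2
      rw [Finset.mem_biUnion]
      rw [abs_le] at hi
      refine ⟨i, Finset.mem_univ _, Finset.mem_Icc.2 ?_⟩
      change τ i - C ≤ (k : ℤ) ∧ (k : ℤ) ≤ τ i + C
      omega
    rw [← Finset.card_map]
    refine (Finset.card_le_card h1).trans (Finset.card_biUnion_le.trans ?_)
    rw [Finset.sum_const_nat (m := 2 * C + 1), Finset.card_univ, Fintype.card_fin]
    intro i _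
    rw [Int.card_Icc]
    omega
  have hBcard : B.card ≤ (L + 1) ^ (L * (2 * C + 1)) := by
    rw [hB, Fintype.card_piFinset]
    calc ∏ k, (if near k then A else {(⋃₀ F)ᶜ}).card
        ≤ ∏ k, (if near k then L + 1 else 1) := by
          refine Finset.prod_le_prod' fun k _ => ?_
          split_ifs
          · exact hAcard
          · simp
      _ = (L + 1) ^ (Finset.univ.filter near).card := by
          rw [Finset.prod_ite, Finset.prod_const, Finset.prod_const_one, mul_one]
      _ ≤ _ := Nat.pow_le_pow_right (by omega) hnearcard
  refine ⟨B.finite_toSet.subset hsub, ?_⟩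
  refine (ncard_le_ncard hsub B.finite_toSet).trans ?_
  rwa [ncard_coe_finset]

/-- The number of words is controlled by the number of approximate tuples of visiting times. -/
theorem ncard_codings_le (f : X → X) (U : Fin L → Set X) (n C : ℕ) (T : Finset (Fin L → ℤ))
    (hT : ∀ x, ∃ τ ∈ T, ∀ t < n, ∀ i, f^[t] x ∈ U i → |(t : ℤ) - τ i| ≤ C) :
    (codings f (range U) n).Finite ∧
      (codings f (range U) n).ncard ≤ T.card * (L + 1) ^ (L * (2 * C + 1)) := by
  classical
  have hF : (range U).Finite := finite_range U
  have hFL : (range U).ncard ≤ L := by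
    rw [← image_univ]
    refine (ncard_image_le finite_univ).trans ?_
    rw [ncard_univ, Nat.card_fin]
  set W : (Fin L → ℤ) → Set (Fin n → Set X) := fun τ =>
    {w | (∀ k, w k ∈ insert (⋃₀ (range U))ᶜ (range U)) ∧
        ∀ k : Fin n, w k ≠ (⋃₀ (range U))ᶜ → ∃ i, |(k : ℤ) - τ i| ≤ C} with hW
  have hWb := fun τ => ncard_words_le (range U) hF hFL n C τ
  have hsub : codings f (range U) n ⊆ ⋃ τ ∈ T, W τ := by
    rintro w ⟨h1, x, hx⟩
    obtain ⟨τ, hτ, h2⟩ := hT x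
    refine mem_iUnion₂.2 ⟨τ, hτ, h1, fun k hk => ?_⟩
    obtain ⟨i, hi⟩ := (h1 k).resolve_left hk
    exact ⟨i, h2 k k.2 i (by rw [hi]; exact hx k)⟩
  have hfin : (⋃ τ ∈ T, W τ).Finite := T.finite_toSet.biUnion fun τ _ => (hWb τ).1
  refine ⟨hfin.subset hsub, (ncard_le_ncard hsub hfin).trans ?_⟩
  refine (Finset.set_ncard_biUnion_le T W).trans ?_
  refine (Finset.sum_le_card_nsmul T _ _ fun τ _ => (hWb τ).2).trans ?_
  rw [smul_eq_mul]

end Words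

/-! ### Orbits of the glued plane -/

/-- The translation from copy `0` to copy `l` at height `y`. -/
def totalShift (φ : ℕ → ℝ → ℝ) (y : ℝ) (l : ℕ) : ℝ := ∑ j ∈ Finset.range l, φ j y

section Plane

variable {L : ℕ} {φ : ℕ → ℝ → ℝ}

/-- Coordinates that determine a point of the glued plane. -/
noncomputable def gluedCoord (L : ℕ) (φ : ℕ → ℝ → ℝ) : GluedPlane L φ → ℝ × ℝ × ℕ :=
  Quot.lift (fun p => if 0 < p.2.2 then (p.2.1 - totalShift φ p.2.2 p.1, p.2.2, 0)
    else (p.2.1, p.2.2, (p.1 : ℕ))) (by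
    rintro _ _ ⟨i, j, hij, x, y, hy⟩
    simp only [hy, if_true, hij, totalShift, Finset.sum_range_succ]
    congr 1
    ring)

theorem gluedCoord_mk (i : Fin L) (x y : ℝ) : gluedCoord L φ (GluedPlane.mk L φ i (x, y)) =
    if 0 < y then (x - totalShift φ y i, y, 0) else (x, y, (i : ℕ)) := rfl

theorem GluedPlane.mk_eq_mk_zero (hL : 0 < L) (i : Fin L) (x : ℝ) {y : ℝ} (hy : 0 < y) :
    GluedPlane.mk L φ i (x, y) = GluedPlane.mk L φ ⟨0, hL⟩ (x - totalShift φ y i, y) := by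
  obtain ⟨i, hi⟩ := i
  induction i generalizing x with
  | zero => simp [totalShift]
  | succ i ih =>
    have h1 := Quot.sound (GlueRel.glue (φ := φ) ⟨i, by omega⟩ ⟨i + 1, hi⟩ rfl (x - φ i y) y hy)
    have h2 := ih (x - φ i y) (by omega)
    simp only [sub_add_cancel] at h1
    refine h1.symm.trans (h2.trans ?_)
    simp only [totalShift, Finset.sum_range_succ]
    congr 2
    ring

theorem compactifiedTranslation_iterate (t : ℕ) (i : Fin L) (x y : ℝ) :
    (compactifiedTranslation L φ)^[t] (GluedPlane.mk L φ i (x, y) : OnePoint (GluedPlane L φ)) =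
      (GluedPlane.mk L φ i (x + t, y) : OnePoint (GluedPlane L φ)) := by
  induction t with
  | zero => simp
  | succ t ih =>
    rw [Function.iterate_succ_apply', ih]
    have : compactifiedTranslation L φ (GluedPlane.mk L φ i (x + t, y)) =
        (GluedPlane.mk L φ i (x + t + 1, y) : OnePoint (GluedPlane L φ)) := rfl
    rw [this]
    push_cast
    rw [add_assoc]

theorem compactifiedTranslation_iterate_infty (t : ℕ) :
    (compactifiedTranslation L φ)^[t] OnePoint.infty = OnePoint.infty :=
  Function.iterate_fixed rfl t

theorem infty_notMem_gluedSquare (i : Fin L) : OnePoint.infty ∉ gluedSquare L φ i := by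
  rintro ⟨q, -, hq⟩
  exact OnePoint.coe_ne_infty _ hq

/-- Above the axis every point has a unique representative in copy `0`, and `gluedCoord` reads it
off. -/
theorem mk_zero_mem_gluedSquare_iff (hL : 0 < L) (l : Fin L) (x : ℝ) {y : ℝ} (hy : 0 < y) :
    (GluedPlane.mk L φ ⟨0, hL⟩ (x, y) : OnePoint (GluedPlane L φ)) ∈ gluedSquare L φ l ↔
      |x + totalShift φ y l| ≤ 2 / 3 ∧ y ≤ 2 / 3 := by
  constructor
  · rintro ⟨⟨x', y'⟩, ⟨⟨hx1, hx2⟩, hy1, hy2⟩, he⟩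
    have h1 := congrArg (gluedCoord L φ) (OnePoint.coe_injective he)
    rw [gluedCoord_mk, gluedCoord_mk, if_pos hy] at h1
    simp only at hx1 hx2 hy1 hy2
    by_cases hy' : 0 < y'
    · rw [if_pos hy'] at h1
      simp only [totalShift, Finset.range_zero, Finset.sum_empty, sub_zero, Prod.mk.injEq,
        and_true] at h1
      obtain ⟨h2, rfl⟩ := h1
      refine ⟨?_, hy2⟩
      rw [← h2, abs_le, totalShift]
      constructor <;> linarith
    · rw [if_neg hy'] at h1
      simp only [Prod.mk.injEq] at h1
      exact absurd (h1.2.1 ▸ hy) hy'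
  · rintro ⟨hx, hy2⟩
    rw [abs_le] at hx
    refine ⟨(x + totalShift φ y l, y), ⟨⟨hx.1, hx.2⟩, by simp only; linarith, hy2⟩, ?_⟩
    simp only
    rw [GluedPlane.mk_eq_mk_zero hL l _ hy, add_sub_cancel_right]

/-- Nothing is glued on or below the axis, so such a point sees only the square of its own copy. -/
theorem of_mk_mem_gluedSquare {i l : Fin L} {x y : ℝ} (hy : y ≤ 0)
    (h : (GluedPlane.mk L φ i (x, y) : OnePoint (GluedPlane L φ)) ∈ gluedSquare L φ l) :
    l = i ∧ |x| ≤ 2 / 3 := by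
  obtain ⟨⟨x', y'⟩, ⟨⟨hx1, hx2⟩, hy1, hy2⟩, he⟩ := h
  have h1 := congrArg (gluedCoord L φ) (OnePoint.coe_injective he)
  rw [gluedCoord_mk, gluedCoord_mk, if_neg (not_lt.2 hy)] at h1
  by_cases hy' : 0 < y'
  · rw [if_pos hy'] at h1
    simp only [Prod.mk.injEq] at h1
    linarith [h1.2.1]
  · rw [if_neg hy'] at h1
    simp only [Prod.mk.injEq] at h1
    obtain ⟨rfl, rfl, h2⟩ := h1
    exact ⟨Fin.ext h2, abs_le.2 ⟨hx1, hx2⟩⟩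

theorem onePoint_gluedPlane_cases (hL : 0 < L) (p : OnePoint (GluedPlane L φ)) :
    p = OnePoint.infty ∨
      (∃ (i : Fin L) (x y : ℝ), y ≤ 0 ∧
        p = (GluedPlane.mk L φ i (x, y) : OnePoint (GluedPlane L φ))) ∨
      ∃ x y : ℝ, 0 < y ∧
        p = (GluedPlane.mk L φ ⟨0, hL⟩ (x, y) : OnePoint (GluedPlane L φ)) := by
  induction p using OnePoint.rec with
  | infty => exact Or.inl rfl
  | coe p =>
    right
    obtain ⟨⟨i, x, y⟩, rfl⟩ := Quot.exists_rep p
    rcases le_or_gt y 0 with hy | hy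
    · exact Or.inl ⟨i, x, y, hy, rfl⟩
    · refine Or.inr ⟨_, y, hy, congrArg OnePoint.some (GluedPlane.mk_eq_mk_zero hL i x hy)⟩

end Plane

/-! ### The upper bound -/

theorem abs_totalShift_le {φ : ℕ → ℝ → ℝ} {y B : ℝ} {L l : ℕ} (hB : 0 ≤ B)
    (h : ∀ j, j + 1 < L → |φ j y| ≤ B) (hl : l < L) : |totalShift φ y l| ≤ L * B := by
  rw [totalShift]
  calc _ ≤ ∑ j ∈ Finset.range l, |φ j y| := Finset.abs_sum_le_sum_abs _ _
    _ ≤ ∑ _j ∈ Finset.range l, B := Finset.sum_le_sum fun j hj => h j (by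
        rw [Finset.mem_range] at hj; omega)
    _ = l * B := by simp
    _ ≤ L * B := by gcongr

/-- This separates by at least `N` the passages near two different squares, so that a short orbit
segment meets only one. -/
theorem totalShift_add_le {φ : ℕ → ℝ → ℝ} {y N : ℝ} {L i l : ℕ} (hN : 0 ≤ N)
    (h : ∀ j, j + 1 < L → φ j y ≤ -N) (hil : i < l) (hl : l < L) :
    totalShift φ y l + N ≤ totalShift φ y i := by
  induction l, hil using Nat.le_induction with
  | base =>
    rw [totalShift, totalShift, Finset.sum_range_succ]
    linarith [h i (by omega)]
  | succ l hil ih =>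
    have h1 := ih (by omega)
    have h2 := h l (by omega)
    rw [totalShift, Finset.sum_range_succ]
    rw [totalShift] at h1
    linarith

/-- The sum of the first `l` entries of `v`. -/
def partialSum {m : ℕ} (v : Fin m → ℤ) (l : ℕ) : ℤ :=
  ∑ j ∈ Finset.range l, if hj : j < m then v ⟨j, hj⟩ else 0

theorem abs_totalShift_sub_partialSum_le {φ : ℕ → ℝ → ℝ} {L l : ℕ} (y : ℝ) (hl : l < L) :
    |totalShift φ y l - partialSum (fun j : Fin (L - 1) => ⌊φ j y⌋) l| ≤ L := by
  rw [totalShift, partialSum]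
  push_cast
  rw [← Finset.sum_sub_distrib]
  calc _ ≤ ∑ _j ∈ Finset.range l, (1 : ℝ) := by
        refine (Finset.abs_sum_le_sum_abs _ _).trans (Finset.sum_le_sum fun j hj => ?_)
        rw [Finset.mem_range] at hj
        rw [dif_pos (by omega)]
        have h1 := Int.floor_le (φ j y)
        have h2 := Int.lt_floor_add_one (φ j y)
        rw [abs_le]
        constructor <;> linarith
    _ = (l : ℝ) := by simp
    _ ≤ L := by exact_mod_cast hl.le

namespace IsTwistedGluing

variable {L : ℕ} {α : ℝ} {φ : ℕ → ℝ → ℝ} {I : ℕ → List ℕ → Set ℝ}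

/-- Up to bounded errors, the visiting times of the squares along orbits of length `n` take at most
about `n ^ α` values. -/
theorem exists_visiting_times (h : IsTwistedGluing L α φ I) (hL : 3 ≤ L)
    (hα : α ∈ Ioc ((L : ℝ) - 1) L) :
    ∃ (C : ℕ) (c : ℝ), ∀ n : ℕ, 1 ≤ n → ∃ T : Finset (Fin L → ℤ), (T.card : ℝ) ≤ c * (n : ℝ) ^ α ∧
      ∀ x, ∃ τ ∈ T, ∀ t < n, ∀ i,
        (compactifiedTranslation L φ)^[t] x ∈ gluedSquare L φ i → |(t : ℤ) - τ i| ≤ C := by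
  classical
  obtain ⟨e, hpos, hle, hcount⟩ := h.exists_order_points hL hα
  obtain ⟨B, hB0, hB⟩ : ∃ B : ℝ, 0 ≤ B ∧ ∀ j, j + 1 < L → ∀ y ∈ Icc (e 1) (2 / 3), |φ j y| ≤ B := by
    have h1 : ∀ j, ∃ B : ℝ, j + 1 < L → ∀ y ∈ Icc (e 1) (2 / 3), |φ j y| ≤ B := by
      intro j
      by_cases hj : j + 1 < L
      · obtain ⟨B, hB⟩ := isCompact_Icc.exists_bound_of_continuousOn ((h.continuousOn j hj).mono
          (fun y (hy : y ∈ Icc (e 1) (2 / 3)) => lt_of_lt_of_le (hpos 1 le_rfl) hy.1))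
        exact ⟨B, fun _ => hB⟩
      · exact ⟨0, fun h => absurd h hj⟩
    choose b hb using h1
    refine ⟨∑ j ∈ Finset.range L, |b j|, Finset.sum_nonneg fun _ _ => abs_nonneg _,
      fun j hj y hy => ?_⟩
    exact (hb j hj y hy).trans ((le_abs_self _).trans
      (Finset.single_le_sum (f := fun j => |b j|) (fun _ _ => abs_nonneg _)
        (Finset.mem_range.2 (by omega))))
  have hL0 : 0 < L := by omega
  -- In the first constant, `2` covers the width `4 / 3` of a square, `2 * L` the rounding of two
  -- partial sums and the last term the difference of two shifts on `[e 1, 2 / 3]`. In the second,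
  -- `1` counts the constant tuples and `4` comes from `n + 3 ≤ 4 * n`.
  refine ⟨2 + 2 * L + ⌈2 * (L * B)⌉₊, 1 + L * (((L : ℝ) ^ 2 + 1) * 4 ^ (α - 1)), fun n hn => ?_⟩
  set C : ℕ := 2 + 2 * L + ⌈2 * (L * B)⌉₊ with hC
  have hCle : 2 + 2 * (L : ℝ) + 2 * (L * B) ≤ C := by
    rw [hC]
    push_cast
    linarith [Nat.le_ceil (2 * (L * B))]
  have hLB : 0 ≤ L * B := by positivity
  have hL0' : (0 : ℝ) ≤ L := Nat.cast_nonneg L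
  -- With shifts at least `n + 2` apart and times at most `n - 1` apart, visits to two different
  -- squares would leave a discrepancy of at least `3 > 4 / 3`.
  obtain ⟨hfin, hcard⟩ := hcount (n + 2) (by omega)
  set FT : Finset (Fin (L - 1) → ℤ) := hfin.toFinset with hFT
  -- `T₁` serves the orbits whose visits are all close to one time; `T₂` predicts all visits from
  -- one visit to a square `i` and the integer parts of the gluing maps.
  set T₁ : Finset (Fin L → ℤ) := Finset.univ.image fun (a : Fin n) _ => (a : ℤ) with hT₁
  set T₂ : Finset (Fin L → ℤ) :=
    ((Finset.univ : Finset (Fin L)) ×ˢ (Finset.univ : Finset (Fin n)) ×ˢ FT).image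
      fun p l => (p.2.1 : ℤ) - (partialSum p.2.2 l - partialSum p.2.2 p.1) with hT₂
  refine ⟨T₁ ∪ T₂, ?_, ?_⟩
  · have hn1 : (1 : ℝ) ≤ n := by exact_mod_cast hn
    have hL3 : (3 : ℝ) ≤ L := by exact_mod_cast hL
    have h1 : T₁.card ≤ n := Finset.card_image_le.trans (by simp)
    have h2 : T₂.card ≤ L * (n * FT.card) := Finset.card_image_le.trans (by simp)
    have h3 : (FT.card : ℝ) ≤ ((L : ℝ) ^ 2 + 1) * (4 ^ (α - 1) * (n : ℝ) ^ (α - 1)) := by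
      rw [hFT, ← ncard_eq_toFinset_card _ hfin]
      refine hcard.trans ?_
      rw [← Real.mul_rpow (by norm_num) (by linarith)]
      have : ((n + 2 : ℕ) : ℝ) + 1 ≤ 4 * n := by push_cast; linarith
      gcongr
      linarith [hα.1]
    have h4 : (n : ℝ) * (n : ℝ) ^ (α - 1) = (n : ℝ) ^ α := by
      rw [← Real.rpow_one_add' (by linarith) (by linarith [hα.1]), add_sub_cancel]
    have h5 : (n : ℝ) ≤ (n : ℝ) ^ α := by
      have := Real.rpow_le_rpow_of_exponent_le hn1 (show 1 ≤ α by linarith [hα.1])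
      rwa [Real.rpow_one] at this
    have h6 : ((T₁ ∪ T₂).card : ℝ) ≤ n + L * (n * FT.card) := by
      exact_mod_cast (Finset.card_union_le _ _).trans (Nat.add_le_add h1 h2)
    calc _ ≤ (n : ℝ) + L * (n * FT.card) := h6
      _ ≤ (n : ℝ) ^ α + L * (n * (((L : ℝ) ^ 2 + 1) * (4 ^ (α - 1) * (n : ℝ) ^ (α - 1)))) := by
          gcongr
      _ = (n : ℝ) ^ α + L * (((L : ℝ) ^ 2 + 1) * 4 ^ (α - 1)) * (n * (n : ℝ) ^ (α - 1)) := by ring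
      _ = _ := by rw [h4]; ring
  · intro p
    have hconst : ∀ a < n, (fun _ => (a : ℤ)) ∈ T₁ ∪ T₂ := fun a ha =>
      Finset.mem_union_left _ (Finset.mem_image.2 ⟨⟨a, ha⟩, Finset.mem_univ _, rfl⟩)
    have hint : ∀ t s : ℤ, |(t : ℝ) - s| ≤ C → |t - s| ≤ (C : ℤ) := fun t s hts => by
      exact_mod_cast hts
    by_cases hvis : ∃ a < n, ∃ i, (compactifiedTranslation L φ)^[a] p ∈ gluedSquare L φ i
    swap
    · push Not at hvis
      exact ⟨_, hconst 0 hn, fun t ht i hi => absurd hi (hvis t ht i)⟩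
    obtain ⟨a, ha, i, hi⟩ := hvis
    rcases onePoint_gluedPlane_cases hL0 p with rfl | ⟨i', x, y, hy, rfl⟩ | ⟨x, y, hy, rfl⟩
    · rw [compactifiedTranslation_iterate_infty] at hi
      exact absurd hi (infty_notMem_gluedSquare i)
    · refine ⟨_, hconst a ha, fun t ht l hl => hint _ _ ?_⟩
      rw [compactifiedTranslation_iterate] at hi hl
      have h1 := abs_le.1 (of_mk_mem_gluedSquare hy hi).2
      have h2 := abs_le.1 (of_mk_mem_gluedSquare hy hl).2
      push_cast
      rw [abs_le]
      constructor <;> linarith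
    · rw [compactifiedTranslation_iterate, mk_zero_mem_gluedSquare_iff hL0 i _ hy] at hi
      obtain ⟨hi, hy2⟩ := hi
      rw [abs_le] at hi
      have hvisit : ∀ t l, (compactifiedTranslation L φ)^[t]
          (GluedPlane.mk L φ ⟨0, hL0⟩ (x, y) : OnePoint (GluedPlane L φ)) ∈ gluedSquare L φ l →
          -(4 / 3) ≤ (t : ℝ) - a + (totalShift φ y l - totalShift φ y i) ∧
            (t : ℝ) - a + (totalShift φ y l - totalShift φ y i) ≤ 4 / 3 := by
        intro t l hl
        rw [compactifiedTranslation_iterate, mk_zero_mem_gluedSquare_iff hL0 l _ hy] at hl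
        have := abs_le.1 hl.1
        constructor <;> linarith
      rcases le_or_gt (e 1) y with hy1 | hy1
      · refine ⟨_, hconst a ha, fun t ht l hl => hint _ _ ?_⟩
        have h1 := hvisit t l hl
        have h2 := abs_le.1 (abs_totalShift_le hB0 (fun j hj => hB j hj y ⟨hy1, hy2⟩) l.2)
        have h3 := abs_le.1 (abs_totalShift_le hB0 (fun j hj => hB j hj y ⟨hy1, hy2⟩) i.2)
        push_cast
        rw [abs_le]
        constructor <;> linarith
      rcases le_or_gt y (e (n + 2)) with hyN | hyN
      · refine ⟨_, hconst a ha, fun t ht l hl => hint _ _ ?_⟩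
        have h1 := hvisit t l hl
        have hle' : ∀ j, j + 1 < L → φ j y ≤ -((n + 2 : ℕ) : ℝ) := fun j hj =>
          hle (n + 2) (by omega) j hj y ⟨hy, hyN⟩
        have ht' : (t : ℝ) + 1 ≤ n := by exact_mod_cast ht
        have ha' : (a : ℝ) + 1 ≤ n := by exact_mod_cast ha
        have ht0 : (0 : ℝ) ≤ t := Nat.cast_nonneg t
        have ha0 : (0 : ℝ) ≤ a := Nat.cast_nonneg a
        rcases lt_trichotomy (l : ℕ) i with hli | hli | hli
        · have h2 := totalShift_add_le (Nat.cast_nonneg _) hle' hli i.2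
          push_cast at h2
          linarith
        · rw [hli, sub_self, add_zero] at h1
          push_cast
          rw [abs_le]
          constructor <;> linarith
        · have h2 := totalShift_add_le (Nat.cast_nonneg _) hle' hli l.2
          push_cast at h2
          linarith
      · refine ⟨_, Finset.mem_union_right _ (Finset.mem_image.2
          ⟨(i, ⟨a, ha⟩, fun j => ⌊φ j y⌋), Finset.mem_product.2 ⟨Finset.mem_univ _,
            Finset.mem_product.2 ⟨Finset.mem_univ _, ?_⟩⟩, rfl⟩), fun t ht l hl => hint _ _ ?_⟩
        · exact (Set.Finite.mem_toFinset hfin).2 ⟨y, ⟨hyN.le, hy1.le⟩, rfl⟩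
        · have h1 := hvisit t l hl
          have h2 := abs_le.1 (abs_totalShift_sub_partialSum_le (φ := φ) y l.2)
          have h3 := abs_le.1 (abs_totalShift_sub_partialSum_le (φ := φ) y i.2)
          push_cast
          rw [abs_le]
          constructor <;> linarith

theorem exists_ncard_codings_le (h : IsTwistedGluing L α φ I) (hL : 3 ≤ L)
    (hα : α ∈ Ioc ((L : ℝ) - 1) L) :
    ∃ c : ℝ, ∀ n : ℕ, 1 ≤ n →
      (codings (compactifiedTranslation L φ) (range (gluedSquare L φ)) n).Finite ∧
      ((codings (compactifiedTranslation L φ) (range (gluedSquare L φ)) n).ncard : ℝ)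
        ≤ c * (n : ℝ) ^ α := by
  obtain ⟨C, c, hC⟩ := h.exists_visiting_times hL hα
  refine ⟨c * (L + 1) ^ (L * (2 * C + 1)), fun n hn => ?_⟩
  obtain ⟨T, hT, hx⟩ := hC n hn
  obtain ⟨h1, h2⟩ := ncard_codings_le _ _ n C T hx
  refine ⟨h1, ?_⟩
  calc _ ≤ ((T.card * (L + 1) ^ (L * (2 * C + 1)) : ℕ) : ℝ) := by exact_mod_cast h2
    _ = T.card * ((L : ℝ) + 1) ^ (L * (2 * C + 1)) := by push_cast; rfl
    _ ≤ c * (n : ℝ) ^ α * ((L : ℝ) + 1) ^ (L * (2 * C + 1)) := by gcongr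
    _ = _ := by ring

end IsTwistedGluing

/-! ### The lower bound -/

section Plane

variable {L : ℕ} {φ : ℕ → ℝ → ℝ}

theorem mk_mem_gluedSquare (i : Fin L) :
    (GluedPlane.mk L φ i (0, 0) : OnePoint (GluedPlane L φ)) ∈ gluedSquare L φ i :=
  ⟨(0, 0), by norm_num, rfl⟩

theorem gluedSquare_injective : Function.Injective (gluedSquare L φ) := by
  intro i l hil
  have := mk_mem_gluedSquare (φ := φ) i
  rw [hil] at this
  exact (of_mk_mem_gluedSquare le_rfl this).1.symm

/-- If the gluing maps take integral values `-δ j` at `y`, there is an orbit that visits the square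
`l` exactly at the time `a + δ 0 + ⋯ + δ (l - 1)`. -/
theorem exists_coding_of_values (hL : 0 < L) {y : ℝ} (hy : 0 < y) (hy2 : y ≤ 2 / 3) (δ : ℕ → ℕ)
    (hδ : ∀ j, j + 1 < L → φ j y = -(δ j : ℝ)) (hδ1 : ∀ j, j + 1 < L → 1 ≤ δ j) (a n : ℕ) :
    ∃ w ∈ codings (compactifiedTranslation L φ) (range (gluedSquare L φ)) n,
      ∀ (l : Fin L) (t : Fin n), w t = gluedSquare L φ l ↔
        (t : ℕ) = a + ∑ j ∈ Finset.range l, δ j := by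
  classical
  set D : ℕ → ℕ := fun l => ∑ j ∈ Finset.range l, δ j with hD
  have hshift : ∀ l, l < L → totalShift φ y l = -(D l : ℝ) := by
    intro l hl
    rw [totalShift, hD]
    push_cast
    rw [← Finset.sum_neg_distrib]
    exact Finset.sum_congr rfl fun j hj => hδ j (by rw [Finset.mem_range] at hj; omega)
  have hlt : ∀ l l', l < l' → l' < L → D l < D l' := by
    intro l l' hll hl'
    refine Finset.sum_lt_sum_of_subset (i := l) (Finset.range_mono hll.le)
      (Finset.mem_range.2 hll) (by simp) (hδ1 l (by omega)) (fun _ _ _ => Nat.zero_le _)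
  have hDinj : ∀ l l' : Fin L, D l = D l' → l = l' := by
    intro l l' he
    rcases lt_trichotomy l l' with hc | hc | hc
    · have := hlt l l' hc l'.2
      omega
    · exact hc
    · have := hlt l' l hc l.2
      omega
  -- With this integral starting abscissa, the orbit is at integral abscissas in every copy. Since
  -- `2 / 3 < 1`, it is in the square `l` only when that abscissa is `0`.
  set p : OnePoint (GluedPlane L φ) := OnePoint.some (GluedPlane.mk L φ ⟨0, hL⟩ (-(a : ℝ), y)) with hp
  have hvisit : ∀ (t : ℕ) (l : Fin L),
      (compactifiedTranslation L φ)^[t] p ∈ gluedSquare L φ l ↔ t = a + D l := by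
    intro t l
    rw [hp, compactifiedTranslation_iterate, mk_zero_mem_gluedSquare_iff hL l _ hy, hshift l l.2]
    constructor
    · rintro ⟨h1, -⟩
      rw [abs_le] at h1
      have h2 : (t : ℝ) < ((a + D l + 1 : ℕ) : ℝ) := by push_cast; linarith
      have h3 : ((a + D l : ℕ) : ℝ) < ((t + 1 : ℕ) : ℝ) := by push_cast; linarith
      rw [Nat.cast_lt] at h2 h3
      omega
    · intro ht
      refine ⟨?_, hy2⟩
      rw [ht]
      push_cast
      rw [show -(a : ℝ) + (a + D l) + -(D l : ℝ) = 0 by ring, abs_zero]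
      norm_num
  -- The partial sums `D l` are strictly increasing, so at most one square is visited at each time
  -- and the choice is forced.
  refine ⟨fun t => if h : ∃ l : Fin L, (t : ℕ) = a + D l then gluedSquare L φ h.choose
    else (⋃₀ range (gluedSquare L φ))ᶜ, ⟨fun t => ?_, p, fun t => ?_⟩, fun l t => ?_⟩
  · simp only
    split_ifs
    · exact Or.inr ⟨_, rfl⟩
    · exact Or.inl rfl
  · simp only
    split_ifs with h
    · exact (hvisit t _).2 h.choose_spec
    · rintro ⟨_, ⟨l, rfl⟩, hl⟩
      exact h ⟨l, (hvisit t l).1 hl⟩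
  · simp only
    split_ifs with h
    · have hs := h.choose_spec
      constructor
      · intro he
        rw [← gluedSquare_injective he]
        exact hs
      · intro he
        congr 1
        apply hDinj
        have he' : (t : ℕ) = a + D l := he
        omega
    · constructor
      · intro he
        have h1 := mk_mem_gluedSquare (φ := φ) l
        have h2 := h1
        rw [← he] at h2
        exact absurd (mem_sUnion_of_mem h1 (mem_range_self l)) h2
      · intro he
        exact absurd ⟨l, he⟩ h

end Plane

theorem isStepIndex_ofFn_snoc {L : ℕ} {α : ℝ} (hL : 3 ≤ L) {k : ℕ} (hk : 1 ≤ k)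
    (b : Fin (L - 3) → ℕ) (hb : ∀ i, b i ≤ k) {m : ℕ} (hm : (m : ℝ) ≤ (k : ℝ) ^ (α - L + 1)) :
    IsStepIndex L α k (List.ofFn (fun i => k + b i) ++ [k + m]) := by
  refine IsStepIndex.snoc_iff.2 ⟨⟨hk, fun i hi => ?_⟩, by omega, ?_⟩
  · rw [List.length_ofFn] at hi
    rw [List.getElem_ofFn, stepTop, if_neg (by omega)]
    have h1 : (b ⟨i, hi⟩ : ℝ) ≤ k := by exact_mod_cast hb ⟨i, hi⟩
    refine ⟨by omega, ?_⟩
    push_cast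
    linarith
  · rw [List.length_ofFn, stepTop, if_pos (by omega)]
    push_cast
    linarith

namespace IsTwistedGluing

variable {L : ℕ} {α : ℝ} {φ : ℕ → ℝ → ℝ} {I : ℕ → List ℕ → Set ℝ}

theorem eq_getD_of_mem_step (h : IsTwistedGluing L α φ I) {k : ℕ} {w : List ℕ}
    (hw : IsStepIndex L α k w) (hwl : w.length + 2 = L) {y : ℝ} (hy : y ∈ I k w) (j : ℕ)
    (hj : j + 1 < L) : φ j y = -((k :: w).getD j 0 : ℝ) := by
  cases j with
  | zero => simpa using h.first_eq hw hwl.le hy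
  | succ j =>
    have hjw : j < w.length := by omega
    have he : w = w.take j ++ w[j] :: w.drop (j + 1) := by
      rw [← List.drop_eq_getElem_cons hjw, List.take_append_drop]
    have h1 := h.succ_eq (he ▸ hw) (by rw [← he]; exact hwl.le) (he ▸ hy)
    rw [List.length_take, min_eq_left hjw.le] at h1
    rw [h1, List.getD_cons_succ, List.getD_eq_getElem _ _ hjw]

/-- Starting time, excess of the order over `M` and the first `L - 3` excesses of the entries over
the order range over `M` values each, and the last excess over `Q + 1 ≥ M ^ (α - L + 1)` values;
different choices give different words. -/
theorem rpow_le_ncard_codings (h : IsTwistedGluing L α φ I) (hL : 3 ≤ L)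
    (hα : α ∈ Ioc ((L : ℝ) - 1) L) {n M : ℕ} (hM : 1 ≤ M) (hn : 4 * L * M ≤ n)
    (hfin : (codings (compactifiedTranslation L φ) (range (gluedSquare L φ)) n).Finite) :
    (M : ℝ) ^ α ≤
      (codings (compactifiedTranslation L φ) (range (gluedSquare L φ)) n).ncard := by
  set Q := ⌊(M : ℝ) ^ (α - L + 1)⌋₊ with hQ
  have hM1 : (1 : ℝ) ≤ M := by exact_mod_cast hM
  have hL0 : 0 < L := by omega
  let P := Fin M × Fin M × (Fin (L - 3) → Fin M) × Fin (Q + 1)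
  let ord : P → ℕ := fun p => M + p.2.1
  let idx : P → List ℕ := fun p => List.ofFn (fun i => ord p + (p.2.2.1 i : ℕ)) ++
    [ord p + (p.2.2.2 : ℕ)]
  let δ : P → ℕ → ℕ := fun p j => (ord p :: idx p).getD j 0
  have hlen : ∀ p, (idx p).length + 2 = L := fun p => by
    simp only [idx, List.length_append, List.length_ofFn, List.length_singleton]
    omega
  have hidx : ∀ p, IsStepIndex L α (ord p) (idx p) := by
    intro p
    refine isStepIndex_ofFn_snoc hL (by simp only [ord]; omega) _ (fun i => ?_) ?_
    · have := (p.2.2.1 i).2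
      simp only [ord]
      omega
    · have h1 : ((p.2.2.2 : ℕ) : ℝ) ≤ Q := by
        have := p.2.2.2.2
        exact_mod_cast (by omega : (p.2.2.2 : ℕ) ≤ Q)
      have h2 : (Q : ℝ) ≤ (M : ℝ) ^ (α - L + 1) := Nat.floor_le (by positivity)
      refine h1.trans (h2.trans ?_)
      refine Real.rpow_le_rpow (by linarith) ?_ (by linarith [hα.1])
      simp only [ord]
      exact_mod_cast Nat.le_add_right _ _
  -- Orders are below `2 * M` and entries at most twice the order. With a starting time below `M`,
  -- all visits then occur before `4 * L * M ≤ n`.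
  have hδ : ∀ p j, j + 1 < L → 1 ≤ δ p j ∧ δ p j ≤ 4 * M := by
    intro p j hj
    have hord : 1 ≤ ord p ∧ ord p ≤ 2 * M := by
      have := p.2.1.2
      simp only [ord]
      omega
    cases j with
    | zero =>
      simp only [δ, List.getD_cons_zero]
      omega
    | succ j =>
      have hjw : j < (idx p).length := by have := hlen p; omega
      simp only [δ, List.getD_cons_succ, List.getD_eq_getElem _ _ hjw]
      obtain ⟨h1, h2⟩ := (hidx p).2 j hjw
      have h3 : ((idx p)[j] : ℝ) ≤ ((2 * ord p : ℕ) : ℝ) := by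
        push_cast
        exact h2.trans (stepTop_le hα.2 hord.1 _)
      rw [Nat.cast_le] at h3
      omega
  have hcode : ∀ p : P, ∃ w ∈ codings (compactifiedTranslation L φ) (range (gluedSquare L φ)) n,
      ∀ (l : Fin L) (t : Fin n), w t = gluedSquare L φ l ↔
        (t : ℕ) = p.1 + ∑ j ∈ Finset.range l, δ p j := by
    intro p
    obtain ⟨y, hy⟩ := h.step_nonempty (hidx p) (hlen p).le
    have hy' := (h.step_basic (hidx p) (hlen p).le).2.2 hy
    exact exists_coding_of_values hL0 hy'.1 hy'.2 (δ p)
      (fun j hj => h.eq_getD_of_mem_step (hidx p) (hlen p) hy j hj) (fun j hj => (hδ p j hj).1) _ n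
  choose g hg hgt using hcode
  have htime : ∀ (p : P) (l : Fin L), p.1 + ∑ j ∈ Finset.range l, δ p j < n := by
    intro p l
    have h1 : ∑ j ∈ Finset.range l, δ p j ≤ l * (4 * M) := by
      refine (Finset.sum_le_card_nsmul _ _ (4 * M) fun j hj => ?_).trans (by simp)
      rw [Finset.mem_range] at hj
      exact (hδ p j (by omega)).2
    have h2 := p.1.2
    have h3 : ((l : ℕ) + 1) * (4 * M) ≤ L * (4 * M) := Nat.mul_le_mul_right _ l.2
    nlinarith
  have hinj : Function.Injective g := by
    intro p q hpq
    have hT : ∀ l, l < L → (p.1 : ℕ) + ∑ j ∈ Finset.range l, δ p j =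
        q.1 + ∑ j ∈ Finset.range l, δ q j := by
      intro l hl
      have h1 := (hgt p ⟨l, hl⟩ ⟨_, htime p ⟨l, hl⟩⟩).2 rfl
      rw [hpq] at h1
      exact (hgt q ⟨l, hl⟩ ⟨_, htime p ⟨l, hl⟩⟩).1 h1
    have h0 : (p.1 : ℕ) = q.1 := by simpa using hT 0 hL0
    -- Differences of successive visiting times recover the values of the gluing maps.
    have hδe : ∀ j, j + 1 < L → δ p j = δ q j := by
      intro j hj
      have h1 := hT j (by omega)
      have h2 := hT (j + 1) hj
      rw [Finset.sum_range_succ, Finset.sum_range_succ] at h2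
      omega
    have hlist : ord p :: idx p = ord q :: idx q := by
      refine List.ext_getElem (by have := hlen p; have := hlen q; simp; omega) fun j hj hj' => ?_
      have := hδe j (by have := hlen p; simp at hj; omega)
      simp only [δ] at this
      rwa [List.getD_eq_getElem _ _ hj, List.getD_eq_getElem _ _ hj'] at this
    obtain ⟨hord, hidxe⟩ := List.cons_eq_cons.1 hlist
    simp only [idx] at hidxe
    obtain ⟨h3, h4⟩ := List.append_inj' hidxe rfl
    rw [List.ofFn_inj] at h3
    have h4' : (p.2.2.2 : ℕ) = q.2.2.2 := by simpa [hord] using h4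
    have h5 : (p.2.1 : ℕ) = q.2.1 := by simpa [ord] using hord
    refine Prod.ext (Fin.ext h0) (Prod.ext (Fin.ext h5) (Prod.ext ?_ (Fin.ext h4')))
    funext i
    have := congrFun h3 i
    simp only [hord] at this
    exact Fin.ext (by omega)
  have hcard : Nat.card P ≤
      (codings (compactifiedTranslation L φ) (range (gluedSquare L φ)) n).ncard := by
    have h1 : (range g).ncard = Nat.card P := by
      rw [← image_univ, ncard_image_of_injective _ hinj, ncard_univ]
    rw [← h1]
    exact ncard_le_ncard (range_subset_iff.2 hg) hfin
  have hP : Nat.card P = M * (M * (M ^ (L - 3) * (Q + 1))) := by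
    simp [P, Nat.card_eq_fintype_card]
  have hMpos : (0 : ℝ) < M := by linarith
  calc (M : ℝ) ^ α = (M : ℝ) ^ (L - 1) * (M : ℝ) ^ (α - L + 1) := by
        rw [← Real.rpow_natCast, ← Real.rpow_add hMpos]
        congr 1
        rw [Nat.cast_sub (by omega)]
        push_cast
        ring
    _ ≤ (M : ℝ) ^ (L - 1) * (Q + 1) := by
        gcongr
        exact (Nat.lt_floor_add_one _).le
    _ = (Nat.card P : ℝ) := by
        rw [hP, show L - 1 = L - 3 + 1 + 1 by omega]
        push_cast
        ring
    _ ≤ _ := by exact_mod_cast hcard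

theorem exists_le_ncard_codings (h : IsTwistedGluing L α φ I) (hL : 3 ≤ L)
    (hα : α ∈ Ioc ((L : ℝ) - 1) L) :
    ∃ c : ℝ, 0 < c ∧ ∀ᶠ n : ℕ in atTop, c * (n : ℝ) ^ α ≤
      (codings (compactifiedTranslation L φ) (range (gluedSquare L φ)) n).ncard := by
  obtain ⟨c', hc'⟩ := h.exists_ncard_codings_le hL hα
  have hLpos : (0 : ℝ) < L := by exact_mod_cast (by omega : 0 < L)
  -- The count is applied with `M = n / (4 * L)`; rounding down costs at most a factor `2` once `n ≥
  -- 4 * L`.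
  refine ⟨(1 / (8 * L)) ^ α, by positivity, ?_⟩
  filter_upwards [eventually_ge_atTop (4 * L)] with n hn
  have hM : 1 ≤ n / (4 * L) := (Nat.one_le_div_iff (by omega)).2 hn
  refine le_trans ?_ (h.rpow_le_ncard_codings hL hα hM (Nat.mul_div_le n (4 * L))
    (hc' n (by omega)).1)
  rw [← Real.mul_rpow (by positivity) (Nat.cast_nonneg n)]
  refine Real.rpow_le_rpow (by positivity) ?_ ?_
  · rw [one_div_mul_eq_div, div_le_iff₀ (by positivity)]
    have h1 : n < 4 * L * (n / (4 * L) + 1) := Nat.lt_mul_div_succ n (by omega)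
    have h2 : n ≤ n / (4 * L) * (8 * L) := by nlinarith
    exact_mod_cast h2
  · have hL3 : (3 : ℝ) ≤ L := by exact_mod_cast hL
    linarith [hα.1]

end IsTwistedGluing

/-- A sequence comparable to `n ^ α` has polynomial growth rate `α`. -/
theorem tendsto_log_div_log_of_le_of_le {u : ℕ → ℝ} {α c c' : ℝ} (hc : 0 < c)
    (h : ∀ᶠ n : ℕ in atTop, c * (n : ℝ) ^ α ≤ u n)
    (h' : ∀ᶠ n : ℕ in atTop, u n ≤ c' * (n : ℝ) ^ α) :
    Tendsto (fun n : ℕ => Real.log (u n) / Real.log n) atTop (𝓝 α) := by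
  have hlog : Tendsto (fun n : ℕ => Real.log n) atTop atTop :=
    Real.tendsto_log_atTop.comp tendsto_natCast_atTop_atTop
  have hlim : ∀ b : ℝ, Tendsto (fun n : ℕ => Real.log b / Real.log n + α) atTop (𝓝 α) := by
    intro b
    simpa using (hlog.const_div_atTop (Real.log b)).add_const α
  refine tendsto_of_tendsto_of_tendsto_of_le_of_le' (hlim c) (hlim c') ?_ ?_
  · filter_upwards [h, eventually_ge_atTop 2] with n h1 hn
    have hn1 : (1 : ℝ) < n := by exact_mod_cast hn
    have hn0 : (0 : ℝ) < (n : ℝ) ^ α := Real.rpow_pos_of_pos (by linarith) α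
    have hl := Real.log_pos hn1
    rw [div_add' _ _ _ hl.ne', div_le_div_iff_of_pos_right hl, ← Real.log_rpow (by linarith),
      ← Real.log_mul hc.ne' hn0.ne']
    exact Real.log_le_log (by positivity) h1
  · filter_upwards [h, h', eventually_ge_atTop 2] with n h0 h1 hn
    have hn1 : (1 : ℝ) < n := by exact_mod_cast hn
    have hn0 : (0 : ℝ) < (n : ℝ) ^ α := Real.rpow_pos_of_pos (by linarith) α
    have hl := Real.log_pos hn1
    have hu : 0 < u n := lt_of_lt_of_le (by positivity) h0
    have hc' : 0 < c' := pos_of_mul_pos_left (hu.trans_le h1) hn0.le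
    rw [div_add' _ _ _ hl.ne', div_le_div_iff_of_pos_right hl, ← Real.log_rpow (by linarith),
      ← Real.log_mul hc'.ne' hn0.ne']
    exact Real.log_le_log hu h1

theorem lemma2p3 (L : ℕ) (hL : 3 ≤ L) (α : ℝ) (hα : α ∈ Set.Ioc ((L : ℝ) - 1) (L : ℝ))
    (φ : ℕ → ℝ → ℝ) (I : ℕ → List ℕ → Set ℝ) (h : IsTwistedGluing L α φ I) :
    polEntropy (compactifiedTranslation L φ) (Set.range (gluedSquare L φ)) = (α : EReal) := by
  obtain ⟨c', hc'⟩ := h.exists_ncard_codings_le hL hα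
  obtain ⟨c, hc, hcl⟩ := h.exists_le_ncard_codings hL hα
  exact ((continuous_coe_real_ereal.tendsto α).comp (tendsto_log_div_log_of_le_of_le hc hcl
    ((eventually_ge_atTop 1).mono fun n hn => (hc' n hn).2))).limsup_eq
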